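/- Let $d\ge 1$, let $T_d$ be the $d$-regular tree with vertex set $V$ and a root $o\in V$, and let $S$ be a finite set. A (finite-valued) invariant process is a probability measure $\nu$ on $S^{V}$ that is invariant under all automorphisms of $T_d$. A sequence $(G_i)$ of finite $d$-regular graphs has large girth if for every $\varepsilon>0$ and all sufficiently large $i$, a uniform random vertex of $G_i$ lies on a cycle of length at most $\lceil 1/\varepsilon\rceil$ with probability at most $\varepsilon$. For such a sequence let $[(G_i)]_S$ be the set of invariant processes $\nu$ on $S^V$ for which there are colorings $f_i:V(G_i)\to S$ such that $\nu$ is the Benjamini–Schramm limit of $(G_i,f_i)$: for every $r$, the law of the isomorphism class of the rooted $S$-colored $r$-neighborhood of a uniform random vertex of $(G_i,f_i)$ converges to the law of the isomorphism class of the rooted $S$-colored $r$-neighborhood of $o$ in $(T_d,\omega)$, where $\omega$ has law $\nu$. An invariant process $\nu$ is called typical, $\nu\in R_d$, if there is a fixed sequence $(n_i)$ of numbers for which $d$-regular graphs on $n_i$ vertices exist, such that, for independent random graphs $\mathbb G_{n_i}$, each uniformly distributed on the $d$-regular simple graphs on the vertex set $\{1,\dots,n_i\}$, with probability $1$ the sequence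 $(\mathbb G_{n_i})$ has large girth and $\nu\in[(\mathbb G_{n_i})]_S$. For a finite $F\subset V$ let $h(F)=-\sum_{x\in S^F}\nu_F(x)\ln\nu_F(x)$ be the entropy of the marginal $\nu_F$ of $\nu$ on $S^F$ (with $0\ln 0=0$). **Theorem 4.3.** For every typical process $\nu\in R_d$, $$h(\text{star of degree } d)\ \ge\ \frac d2\, h(\text{edge}),$$ that is, for every vertex $z$ and every edge $\{u,w\}$ of $T_d$, $h(\{z\}\cup N(z))\ge \frac d2\,h(\{u,w\})$, where $N(z)$ is the set of neighbors of $z$. -/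

import Mathlib

open MeasureTheory ProbabilityTheory Filter Topology

noncomputable section

namespace TypicalProcess

/-! ### Invariant processes on the regular tree -/

/-- `T` is the `d`-regular tree (unique up to isomorphism). -/
structure IsRegularTree {V : Type*} (d : ℕ) (T : SimpleGraph V) [T.LocallyFinite] : Prop where
  isTree : T.IsTree
  regular : T.IsRegularOfDegree d

/-- `ν` is an `Aut(T)`-invariant probability measure on the `S`-labellings of the vertices of `T`.
An automorphism `φ` acts on a labelling by giving `v` the label of its inverse image `φ⁻¹ v`. -/
structure IsInvariantProcess {V S : Type*} [MeasurableSpace S] (T : SimpleGraph V)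
    (ν : Measure (V → S)) : Prop where
  isProbabilityMeasure : IsProbabilityMeasure ν
  invariant : ∀ φ : T ≃g T, ν.map (fun ω v => ω (φ.symm v)) = ν

/-! ### Large girth sequences and Benjamini--Schramm limits -/

/-- A sequence of finite graphs has large girth if for every `ε > 0` and all large `i`, a uniform
random vertex of the `i`-th graph lies on a cycle of length at most `⌈1/ε⌉` with probability at
most `ε`. -/
def IsLargeGirth {n : ℕ → ℕ} (G : ∀ i, SimpleGraph (Fin (n i))) : Prop :=
  ∀ ε : ℝ, 0 < ε → ∃ N : ℕ, ∀ i ≥ N,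
    ({v : Fin (n i) | ∃ p : (G i).Walk v v, p.IsCycle ∧ p.length ≤ ⌈1 / ε⌉₊}.ncard : ℝ) / n i ≤ ε

/-- The vertices at distance at most `r` from `v`. -/
def closedBall {V : Type*} (G : SimpleGraph V) (v : V) (r : ℕ) : Set V :=
  {u | G.edist v u ≤ r}

theorem center_mem_closedBall {V : Type*} (G : SimpleGraph V) (v : V) (r : ℕ) :
    v ∈ closedBall G v r := by
  simp [closedBall]

/-- The radius `r` neighbourhood of `v` in `G`, rooted at `v` and coloured by the restriction of
`f`, is isomorphic, as a rooted coloured graph, to `H` with root `x` and colouring `c`. -/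
def NbhdIso {V W S : Type*} (G : SimpleGraph V) (f : V → S) (v : V) (r : ℕ)
    (H : SimpleGraph W) (c : W → S) (x : W) : Prop :=
  ∃ φ : G.induce (closedBall G v r) ≃g H,
    φ ⟨v, center_mem_closedBall G v r⟩ = x ∧ ∀ u, c (φ u) = f u

/-- The law `ν` of a random `S`-labelling of `T` with root `o` is the Benjamini--Schramm limit of
the finite coloured graphs `(G i, f i)`: for each radius `r`, the law of the rooted coloured
`r`-neighbourhood of a uniform random vertex of `G i` converges to the law of the rooted coloured
`r`-neighbourhood of `o` under `ν`. These are laws on the countable discrete set of isomorphism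
classes of finite rooted coloured graphs and `ν` is a probability measure, so that weak
convergence is convergence of the probability of each class `(H, c, x)`. -/
def IsBSLimit {V S : Type*} [MeasurableSpace S] (T : SimpleGraph V) (o : V)
    {n : ℕ → ℕ} (G : ∀ i, SimpleGraph (Fin (n i))) (f : ∀ i, Fin (n i) → S)
    (ν : Measure (V → S)) : Prop :=
  ∀ (r m : ℕ) (H : SimpleGraph (Fin m)) (c : Fin m → S) (x : Fin m),
    Tendsto (fun i => ({v : Fin (n i) | NbhdIso (G i) (f i) v r H c x}.ncard : ℝ) / n i) atTop
      (𝓝 (ν.real {ω : V → S | NbhdIso T ω o r H c x}))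

/-- `ν ∈ [G]_S`: the sequence `G` has large girth and `ν` is an invariant process that is the
Benjamini--Schramm limit of some `S`-colourings of `G`. -/
def MemProfile {V S : Type*} [MeasurableSpace S] (T : SimpleGraph V) (o : V)
    {n : ℕ → ℕ} (G : ∀ i, SimpleGraph (Fin (n i))) (ν : Measure (V → S)) : Prop :=
  IsLargeGirth G ∧ IsInvariantProcess T ν ∧ ∃ f : ∀ i, Fin (n i) → S, IsBSLimit T o G f ν

/-! ### Random regular graphs and typical processes -/

/-- All sets of graphs on a finite vertex set are measurable events. -/
instance (n : ℕ) : MeasurableSingletonClass (SimpleGraph (Fin n)) where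
  measurableSet_singleton G := by
    have h := measurableSet_eq_fun (α := SimpleGraph (Fin n)) (f := SimpleGraph.edgeSet)
      (g := fun _ => G.edgeSet) SimpleGraph.measurable_edgeSet measurable_const
    simpa using h

open Classical in
/-- The set of (labelled, simple) `d`-regular graphs on `n` vertices. -/
def regularGraphs (d n : ℕ) : Set (SimpleGraph (Fin n)) :=
  {G | G.IsRegularOfDegree d}

/-- The law of a sequence of independent graphs, the `i`-th one uniformly distributed on the
`d`-regular graphs on `n i` vertices. -/
def randomRegularGraphs (d : ℕ) (n : ℕ → ℕ) : Measure (∀ i, SimpleGraph (Fin (n i))) :=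
  Measure.infinitePi fun i => uniformOn (regularGraphs d (n i))

/-- `ν ∈ R_d`: for some fixed sequence `n i` of numbers of vertices (for which `d`-regular graphs
exist), `ν` belongs with probability one to the profile of a sequence of independent uniform
random `d`-regular graphs on `n i` vertices. -/
def IsTypical {V S : Type*} [MeasurableSpace S] (d : ℕ) (T : SimpleGraph V) (o : V)
    (ν : Measure (V → S)) : Prop :=
  IsInvariantProcess T ν ∧
    ∃ n : ℕ → ℕ, (∀ i, (regularGraphs d (n i)).Nonempty) ∧
      ∀ᵐ G ∂(randomRegularGraphs d n), MemProfile T o G ν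

/-! ### Configuration entropy -/

/-- The entropy `-∑ p log p` of a probability distribution on a finite set. -/
def entropy {A : Type*} [Fintype A] [MeasurableSpace A] (μ : Measure A) : ℝ :=
  ∑ a, Real.negMulLog (μ.real {a})

open Classical in
/-- The configuration entropy `h(F)`: the entropy of the marginal of `ν` on the labellings of the
finite set `F` of vertices. -/
def configEntropy {V S : Type*} [Fintype S] [MeasurableSpace S] (ν : Measure (V → S))
    (F : Finset V) : ℝ :=
  entropy (ν.map F.restrict)

open Classical in
/-- The vertex set of the star around `o`: the vertex `o` and all of its neighbours. -/
def star {V : Type*} (T : SimpleGraph V) [T.LocallyFinite] (o : V) : Finset V :=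
  insert o (T.neighborFinset o)

open Classical in
/-- The vertex set `{u, w}` of an edge. -/
def edge {V : Type*} (u w : V) : Finset V := {u, w}

end TypicalProcess

end

/-! The proof counts finite graphs in two ways. A ported graph is a `d`-regular graph on `n`
vertices with an enumeration of every neighbourhood, that is, a matching of the `M = d n` half-edges
that yields a simple graph. To exponential order there are at least `exp ((M log M - M) / 2)` of
them (`exists_numPorted_lower_bound`). Instead of an analysis of the configuration model, the bound
comes from growth: inserting two vertices into a graph on `n` vertices multiplies the count by at
least `(d n - 4 d ^ 2) ^ d` (`card_regFinset_mul_le`).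

If `ν` is typical, at least half of the graphs for some large `n` have a colouring whose star
statistics are close to those of `ν` (`IsTypical.exists_nearlyTypical`). A coloured ported graph is
determined by the label of the star at each vertex and by the matching of half-edges, which must
pair type `(a, b)` with type `(b, a)` (`card_mul_le_sum_typedMatchings`). Let `H` and `h` be the
star and edge entropies. There are at most `exp (n (H + o(1)))` admissible star labels, by a cross
entropy bound. For each of them, the number of typed matchings is at most the square root of the
product of the factorials of the type counts (`card_typedMatchings_sq_le`), which is `exp ((M log M
- M - M h) / 2 + o(n))`.

Comparing both counts cancels `(M log M - M) / 2` and leaves `d n h / 2 ≤ n H + o(n)`. Invariance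
enters because automorphisms of the tree realise every bijection between two neighbourhoods
(`exists_iso_of_bijOn`): the star marginal is the same at all vertices and symmetric in its leaves,
so the unordered neighbourhood statistics determine it. -/

noncomputable section

namespace TypicalProcess

/-! ### Automorphisms of the regular tree -/

section TreeAutomorphism

variable {V : Type*} {T : SimpleGraph V}

/-- The children of `x` in the tree `T` rooted at `u`. -/
def children (T : SimpleGraph V) (u x : V) : Set V :=
  {v | T.Adj x v ∧ T.dist u v = T.dist u x + 1}

theorem exists_mem_children (hT : T.IsTree) {u v : V} (huv : v ≠ u) :
    ∃ x, v ∈ children T u x := by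
  obtain ⟨p, hp⟩ := hT.connected.exists_walk_length_eq_dist v u
  cases p with
  | nil => exact absurd rfl huv
  | @cons _ x _ h q =>
    refine ⟨x, h.symm, ?_⟩
    rw [SimpleGraph.Walk.length_cons] at hp
    have h1 := SimpleGraph.dist_le q
    rw [SimpleGraph.dist_comm] at hp h1
    have h2 := hT.dist_eq_dist_add_one_of_adj u h
    omega

theorem eq_of_mem_children (hT : T.IsTree) {u v x y : V} (hx : v ∈ children T u x)
    (hy : v ∈ children T u y) : x = y := by
  have key : ∀ z, v ∈ children T u z → ∃ p : T.Walk v u, p.IsPath ∧ p.snd = z := by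
    intro z hz
    obtain ⟨p, hp⟩ := hT.connected.exists_walk_length_eq_dist z u
    refine ⟨.cons hz.1.symm p, SimpleGraph.Walk.isPath_of_length_eq_dist _ ?_, by simp⟩
    rw [SimpleGraph.Walk.length_cons, hp, SimpleGraph.dist_comm, SimpleGraph.dist_comm (u := v),
      hz.2]
  obtain ⟨p, hp, rfl⟩ := key x hx
  obtain ⟨q, hq, rfl⟩ := key y hy
  rw [(hT.existsUnique_path v u).unique hp hq]

theorem adj_iff_mem_children (hT : T.IsTree) (u : V) {x y : V} :
    T.Adj x y ↔ y ∈ children T u x ∨ x ∈ children T u y := by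
  constructor
  · intro h
    rcases hT.dist_eq_dist_add_one_of_adj u h with h1 | h1
    · exact Or.inr ⟨h.symm, h1⟩
    · exact Or.inl ⟨h, h1⟩
  · rintro (h | h)
    · exact h.1
    · exact h.1.symm

theorem children_self (T : SimpleGraph V) (u : V) : children T u u = T.neighborSet u := by
  ext v
  simp only [children, Set.mem_ofPred_eq, SimpleGraph.mem_neighborSet, SimpleGraph.dist_self,
    zero_add, and_iff_left_iff_imp]
  exact fun h => SimpleGraph.dist_eq_one_iff_adj.2 h

variable [T.LocallyFinite] {d : ℕ}

theorem IsRegularTree.ncard_neighborSet (hT : IsRegularTree d T) (u : V) :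
    (T.neighborSet u).ncard = d := by
  rw [Set.ncard_eq_toFinset_card', Set.toFinset_card, SimpleGraph.card_neighborSet_eq_degree]
  exact hT.regular u

theorem finite_children (u x : V) : (children T u x).Finite :=
  (Set.toFinite (T.neighborSet x)).subset fun _ h => h.1

/-- Away from the root, the neighbours of `x` are its children and its unique parent. -/
theorem ncard_children_add_one (hT : IsRegularTree d T) {u x : V} (hx : x ≠ u) :
    (children T u x).ncard + 1 = d := by
  obtain ⟨y, hy⟩ := exists_mem_children hT.isTree hx
  have hy' : y ∉ children T u x := fun h => by
    have := h.2
    have := hy.2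
    omega
  rw [← hT.ncard_neighborSet x, ← Set.ncard_insert_of_notMem hy' (finite_children u x)]
  congr 1
  ext v
  simp only [Set.mem_insert_iff, SimpleGraph.mem_neighborSet, adj_iff_mem_children hT.isTree u]
  constructor
  · rintro (rfl | h)
    · exact Or.inr hy
    · exact Or.inl h
  · rintro (h | h)
    · exact Or.inr h
    · exact Or.inl (eq_of_mem_children hT.isTree h hy)

/-- The local step of the automorphism: `f` at the roots, an arbitrary bijection of `d - 1` children
elsewhere. It is stated for all pairs `x, y`, with a junk value when only one is a root, so that the
bijections can be chosen before the image of `x` is known. -/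
theorem exists_bijOn_children (hT : IsRegularTree d T) {u w : V} {f : V → V}
    (hf : Set.BijOn f (T.neighborSet u) (T.neighborSet w)) (x y : V) :
    ∃ b : V → V, ((x = u ↔ y = w) → Set.BijOn b (children T u x) (children T w y)) ∧
      (x = u → y = w → b = f) := by
  by_cases hxy : x = u ∧ y = w
  · obtain ⟨rfl, rfl⟩ := hxy
    exact ⟨f, fun _ => by rwa [children_self T, children_self T], fun _ _ => rfl⟩
  · by_cases h : x = u ↔ y = w
    · have hx : x ≠ u := fun hx => hxy ⟨hx, h.1 hx⟩
      have hy : y ≠ w := fun hy => hxy ⟨h.2 hy, hy⟩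
      have h1 := ncard_children_add_one hT hx
      have h2 := ncard_children_add_one hT hy
      have : Nonempty V := ⟨u⟩
      obtain ⟨b, hb⟩ := (finite_children (T := T) u x).exists_bijOn_of_encard_eq
        (t := children T w y) (by
          rw [← (finite_children u x).cast_ncard_eq, ← (finite_children w y).cast_ncard_eq]
          exact congrArg _ (by omega))
      exact ⟨b, fun _ => hb, fun h1 h2 => absurd ⟨h1, h2⟩ hxy⟩
    · exact ⟨id, fun h' => absurd h' h, fun h1 h2 => absurd ⟨h1, h2⟩ hxy⟩

/-- In a regular tree, any bijection between the neighbourhoods of two vertices extends to an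
automorphism. -/
theorem exists_iso_of_bijOn (hT : IsRegularTree d T) {u w : V} {f : V → V}
    (hf : Set.BijOn f (T.neighborSet u) (T.neighborSet w)) :
    ∃ φ : T ≃g T, φ u = w ∧ ∀ v ∈ T.neighborSet u, φ v = f v := by
  choose β hβ hβf using exists_bijOn_children hT hf
  have hpar : ∀ v, ∃ x, v ≠ u → v ∈ children T u x := fun v => by
    by_cases h : v = u
    · exact ⟨v, fun h' => absurd h h'⟩
    · obtain ⟨x, hx⟩ := exists_mem_children hT.isTree h
      exact ⟨x, fun _ => hx⟩
  choose par hpar using hpar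
  have par_eq : ∀ {v x}, v ∈ children T u x → par v = x := fun {v x} h => by
    have hv : v ≠ u := by
      rintro rfl
      have := h.2
      rw [SimpleGraph.dist_self] at this
      omega
    exact eq_of_mem_children hT.isTree (hpar v hv) h
  -- Recursion on the distance from `u`: a vertex is sent to the child of the image of its parent
  -- that the chosen bijection prescribes.
  let F : ℕ → V → V := fun n => Nat.rec (fun _ => w) (fun _ g v => β (par v) (g (par v)) v) n
  let φ : V → V := fun v => F (T.dist u v) v
  have hφu : φ u = w := by simp [φ, F]
  have hφc : ∀ {v x}, v ∈ children T u x → φ v = β x (φ x) v := fun {v x} h => by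
    simp only [φ, h.2, F, par_eq h]
  have hdist0 : ∀ {a b : V}, T.dist a b = 0 ↔ b = a := fun {a b} => by
    rw [hT.isTree.connected.dist_eq_zero_iff, eq_comm]
  have hdist : ∀ n v, T.dist u v = n → T.dist w (φ v) = n := by
    intro n
    induction n with
    | zero =>
      intro v hv
      rw [hdist0.1 hv, hφu, SimpleGraph.dist_self]
    | succ n ih =>
      intro v hv
      have hvu : v ≠ u := fun h => by
        rw [hdist0.2 h] at hv
        omega
      have hc := hpar v hvu
      have hd : T.dist u (par v) = n := by
        have := hc.2
        omega
      have hd' := ih _ hd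
      have hm := (hβ (par v) (φ (par v)) (by rw [← hdist0, ← hdist0, hd, hd'])).mapsTo hc
      rw [← hφc hc] at hm
      rw [hm.2, hd']
  have hbij : ∀ x, Set.BijOn (β x (φ x)) (children T u x) (children T w (φ x)) := fun x =>
    hβ _ _ (by rw [← hdist0, ← hdist0, hdist _ x rfl])
  have hchild : ∀ {v x}, v ∈ children T u x → φ v ∈ children T w (φ x) := fun {v x} h => by
    rw [hφc h]
    exact (hbij x).mapsTo h
  have hinj : ∀ n v v', T.dist u v = n → φ v = φ v' → v = v' := by
    intro n
    induction n with
    | zero =>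
      intro v v' hv h
      have h1 := hdist _ v rfl
      rw [h, hdist _ v' rfl, hv] at h1
      rw [hdist0.1 hv, hdist0.1 h1]
    | succ n ih =>
      intro v v' hv h
      have h1 := hdist _ v rfl
      rw [h, hdist _ v' rfl, hv] at h1
      have hne : ∀ {z}, T.dist u z = n + 1 → z ≠ u := fun hz h => by
        rw [hdist0.2 h] at hz
        omega
      have hc := hpar v (hne hv)
      have hc' := hpar v' (hne h1)
      have hp : par v = par v' := by
        refine ih _ _ (by have := hc.2; omega) ?_
        refine eq_of_mem_children hT.isTree (hchild hc) ?_
        rw [h]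
        exact hchild hc'
      rw [← hp] at hc'
      rw [hφc hc, hφc hc'] at h
      exact (hbij _).injOn hc hc' h
  have hsurj : ∀ n y, T.dist w y = n → ∃ v, φ v = y := by
    intro n
    induction n with
    | zero =>
      intro y hy
      exact ⟨u, by rw [hφu, hdist0.1 hy]⟩
    | succ n ih =>
      intro y hy
      obtain ⟨z, hz⟩ := exists_mem_children hT.isTree (u := w) (v := y) fun h => by
        rw [hdist0.2 h] at hy
        omega
      obtain ⟨x, rfl⟩ := ih z (by have := hz.2; omega)
      obtain ⟨v, hv, rfl⟩ := (hbij x).surjOn hz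
      exact ⟨v, hφc hv⟩
  have hchild_iff : ∀ {v x}, φ v ∈ children T w (φ x) ↔ v ∈ children T u x := by
    refine fun {v x} => ⟨fun h => ?_, hchild⟩
    have hvu : v ≠ u := fun hv => by
      have := h.2
      rw [hv, hφu, SimpleGraph.dist_self] at this
      omega
    have hc := hpar v hvu
    rwa [hinj _ _ _ rfl (eq_of_mem_children hT.isTree (hchild hc) h)] at hc
  refine ⟨⟨Equiv.ofBijective φ ⟨fun v v' h => hinj _ v v' rfl h, fun y => hsurj _ y rfl⟩, ?_⟩,
    hφu, fun v hv => ?_⟩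
  · intro a b
    change T.Adj (φ a) (φ b) ↔ T.Adj a b
    rw [adj_iff_mem_children hT.isTree w, adj_iff_mem_children hT.isTree u, hchild_iff, hchild_iff]
  · rw [← children_self T] at hv
    change φ v = f v
    rw [hφc hv, hβf _ _ rfl hφu]

/-- Enumerations of the neighbourhoods of two vertices are related by an automorphism. -/
theorem exists_iso_of_equiv (hT : IsRegularTree d T) {u w : V} (ρ : Fin d ≃ T.neighborSet u)
    (ρ' : Fin d ≃ T.neighborSet w) :
    ∃ φ : T ≃g T, φ u = w ∧ ∀ i, φ (ρ i) = ρ' i := by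
  classical
  let f : V → V := fun v => if h : v ∈ T.neighborSet u then ρ' (ρ.symm ⟨v, h⟩) else v
  have hf : ∀ v (h : v ∈ T.neighborSet u), f v = ρ' (ρ.symm ⟨v, h⟩) := fun v h => dif_pos h
  obtain ⟨φ, h1, h2⟩ := exists_iso_of_bijOn hT (f := f) (u := u) (w := w) (by
    refine ⟨fun v hv => ?_, fun v hv v' hv' h => ?_, fun y hy => ?_⟩
    · rw [hf v hv]
      exact (ρ' _).2
    · rw [hf v hv, hf v' hv'] at h
      simpa using ρ.symm.injective (ρ'.injective (Subtype.ext h))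
    · exact ⟨ρ (ρ'.symm ⟨y, hy⟩), (ρ _).2, by rw [hf _ (ρ _).2]; simp⟩)
  exact ⟨φ, h1, fun i => by rw [h2 _ (ρ i).2, hf _ (ρ i).2]; simp⟩

end TreeAutomorphism

/-! ### Marginals of invariant processes -/

section Marginals

variable {V S ι : Type*} [MeasurableSpace S]

/-- The probability that the labelling of the points `e i` is `c i`. -/
def patternProb (ν : Measure (V → S)) (e : ι → V) (c : ι → S) : ℝ :=
  ν.real {ω | ω ∘ e = c}

theorem patternProb_nonneg (ν : Measure (V → S)) (e : ι → V) (c : ι → S) :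
    0 ≤ patternProb ν e c :=
  measureReal_nonneg

theorem measurable_comp_right (e : ι → V) : Measurable fun ω : V → S => ω ∘ e :=
  measurable_pi_iff.2 fun i => measurable_pi_apply (e i)

theorem IsInvariantProcess.patternProb_comp_iso [Countable ι] [MeasurableSingletonClass S]
    {T : SimpleGraph V} {ν : Measure (V → S)} (hν : IsInvariantProcess T ν) (φ : T ≃g T)
    (e : ι → V) (c : ι → S) : patternProb ν (φ ∘ e) c = patternProb ν e c := by
  have h := hν.invariant φ.symm
  have hm : Measurable fun (ω : V → S) v => ω (φ.symm.symm v) :=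
    measurable_pi_iff.2 fun i => measurable_pi_apply _
  have hs : MeasurableSet {ω : V → S | ω ∘ e = c} :=
    measurable_comp_right e (measurableSet_singleton c)
  unfold patternProb
  conv_rhs => rw [← h, map_measureReal_apply hm hs]
  rfl

section Finite

variable [Fintype ι] [DecidableEq ι] [Fintype S] [MeasurableSingletonClass S]

theorem measureReal_comp_eq_sum (ν : Measure (V → S)) [IsFiniteMeasure ν] (e : ι → V)
    (Q : (ι → S) → Prop) [DecidablePred Q] :
    ν.real {ω | Q (ω ∘ e)} = ∑ c with Q c, patternProb ν e c := by
  have h : {ω : V → S | Q (ω ∘ e)} =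
      ⋃ c ∈ Finset.univ.filter Q, {ω : V → S | ω ∘ e = c} := by
    ext ω
    simp
  rw [h, measureReal_biUnion_finset]
  · rfl
  · intro c _ c' _ hcc'
    refine Set.disjoint_left.2 fun ω h1 h2 => hcc' ?_
    simp only [Set.mem_ofPred_eq] at h1 h2
    exact h1.symm.trans h2
  · intro c _
    exact measurable_comp_right e (measurableSet_singleton c)

theorem sum_patternProb (ν : Measure (V → S)) [IsProbabilityMeasure ν] (e : ι → V) :
    ∑ c, patternProb ν e c = 1 := by
  have h := measureReal_comp_eq_sum ν e fun _ => True
  simpa using h.symm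

theorem configEntropy_eq_sum (ν : Measure (V → S)) {e : ι → V} (he : Function.Injective e)
    {F : Finset V} (hF : ∀ v, v ∈ F ↔ ∃ i, e i = v) :
    configEntropy ν F = ∑ c : ι → S, Real.negMulLog (patternProb ν e c) := by
  let ε : ι ≃ F := Equiv.ofBijective (fun i => ⟨e i, (hF _).2 ⟨i, rfl⟩⟩)
    ⟨fun i j h => he (Subtype.ext_iff.1 h), fun v => by
      obtain ⟨i, hi⟩ := (hF v).1 v.2
      exact ⟨i, Subtype.ext hi⟩⟩
  classical
  unfold configEntropy entropy
  refine Fintype.sum_equiv (Equiv.arrowCongr ε.symm (Equiv.refl S)) _ _ fun x => ?_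
  congr 1
  rw [map_measureReal_apply (Finset.measurable_restrict F) (measurableSet_singleton x)]
  unfold patternProb
  congr 1
  ext ω
  simp only [Set.mem_preimage, Set.mem_singleton_iff, Set.mem_ofPred_eq]
  constructor
  · rintro rfl
    rfl
  · intro h
    funext v
    obtain ⟨i, rfl⟩ := ε.surjective v
    have : ω (e i) = x (ε i) := by simpa using congrFun h i
    exact this

end Finite

end Marginals

/-! ### The marginal on the star -/

section StarMarginal

variable {V S : Type*} {T : SimpleGraph V} {d : ℕ}

/-- The enumeration of the star around `o` given by an enumeration of the neighbours of `o`. -/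
def starEmb {o : V} (ρ : Fin d ≃ T.neighborSet o) : Fin (d + 1) → V :=
  Fin.cons o fun i => ρ i

@[simp]
theorem starEmb_zero {o : V} (ρ : Fin d ≃ T.neighborSet o) : starEmb ρ 0 = o := rfl

@[simp]
theorem starEmb_succ {o : V} (ρ : Fin d ≃ T.neighborSet o) (i : Fin d) :
    starEmb ρ i.succ = ρ i := rfl

theorem starEmb_injective {o : V} (ρ : Fin d ≃ T.neighborSet o) :
    Function.Injective (starEmb ρ) := by
  refine Fin.cons_injective_iff.2 ⟨?_, Subtype.val_injective.comp ρ.injective⟩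
  rintro ⟨i, hi⟩
  exact (ρ i).2.ne hi.symm

theorem comp_starEmb {o : V} (ρ : Fin d ≃ T.neighborSet o) (φ : V → V) {w : V}
    (ρ' : Fin d ≃ T.neighborSet w) (h0 : φ o = w) (h : ∀ i, φ (ρ i) = ρ' i) :
    φ ∘ starEmb ρ = starEmb ρ' := by
  funext i
  refine Fin.cases h0 (fun i => h i) i

/-- Two labellings of the star agree up to a permutation of the leaves. -/
def SameStar (c c' : Fin (d + 1) → S) : Prop :=
  c' 0 = c 0 ∧ ∃ π : Equiv.Perm (Fin d), ∀ i, c' i.succ = c (π i).succ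

theorem SameStar.refl (c : Fin (d + 1) → S) : SameStar c c := ⟨rfl, 1, fun _ => rfl⟩

theorem SameStar.symm {c c' : Fin (d + 1) → S} (h : SameStar c c') : SameStar c' c := by
  obtain ⟨h0, π, h⟩ := h
  exact ⟨h0.symm, π.symm, fun i => by rw [h, Equiv.apply_symm_apply]⟩

theorem SameStar.trans {c c' c'' : Fin (d + 1) → S} (h : SameStar c c') (h' : SameStar c' c'') :
    SameStar c c'' := by
  obtain ⟨h0, π, h⟩ := h
  obtain ⟨h0', π', h'⟩ := h'
  exact ⟨h0'.trans h0, π'.trans π, fun i => by rw [h', h, Equiv.trans_apply]⟩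

variable [T.LocallyFinite]

theorem mem_star_iff {o : V} (ρ : Fin d ≃ T.neighborSet o) (v : V) :
    v ∈ star T o ↔ ∃ i, starEmb ρ i = v := by
  simp only [star, Finset.mem_insert, SimpleGraph.mem_neighborFinset, Fin.exists_fin_succ,
    starEmb_zero, starEmb_succ, eq_comm (a := v)]
  refine or_congr_right ⟨fun h => ⟨ρ.symm ⟨v, h⟩, by simp⟩, ?_⟩
  rintro ⟨i, rfl⟩
  exact (ρ i).2

theorem IsRegularTree.exists_equiv (hT : IsRegularTree d T) (o : V) :
    Nonempty (Fin d ≃ T.neighborSet o) :=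
  ⟨(Fintype.equivFinOfCardEq (by
    rw [SimpleGraph.card_neighborSet_eq_degree]; exact hT.regular o)).symm⟩

theorem IsRegularTree.exists_equiv_apply_eq (hT : IsRegularTree d T) {u w : V} (huw : T.Adj u w)
    (i : Fin d) : ∃ ρ : Fin d ≃ T.neighborSet u, ρ i = w := by
  obtain ⟨ρ⟩ := hT.exists_equiv u
  exact ⟨(Equiv.swap i (ρ.symm ⟨w, huw⟩)).trans ρ, by simp⟩

variable [MeasurableSpace S] [Fintype S] [MeasurableSingletonClass S] {ν : Measure (V → S)}

omit [Fintype S] in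
theorem IsInvariantProcess.patternProb_star (hν : IsInvariantProcess T ν)
    (hT : IsRegularTree d T) {u w : V} (ρ : Fin d ≃ T.neighborSet u) (ρ' : Fin d ≃ T.neighborSet w)
    (c : Fin (d + 1) → S) : patternProb ν (starEmb ρ') c = patternProb ν (starEmb ρ) c := by
  obtain ⟨φ, h0, h⟩ := exists_iso_of_equiv hT ρ ρ'
  rw [← hν.patternProb_comp_iso φ (starEmb ρ) c, comp_starEmb ρ φ ρ' h0 h]

omit [Fintype S] in
-- Any permutation of the leaves extends to an automorphism fixing `o`, so permuting the labels of
-- the leaves does not change the probability.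
theorem IsInvariantProcess.patternProb_eq_of_sameStar (hν : IsInvariantProcess T ν)
    (hT : IsRegularTree d T) {o : V} (ρ : Fin d ≃ T.neighborSet o) {c c' : Fin (d + 1) → S}
    (h : SameStar c c') : patternProb ν (starEmb ρ) c' = patternProb ν (starEmb ρ) c := by
  obtain ⟨h0, π, h⟩ := h
  rw [← hν.patternProb_star hT ρ (π.trans ρ) c']
  unfold patternProb
  congr 1
  ext ω
  simp only [Set.mem_ofPred_eq, funext_iff, Fin.forall_fin_succ, Function.comp_apply, starEmb_zero,
    starEmb_succ, Equiv.trans_apply, h0, h]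
  refine and_congr_right fun _ => ⟨fun h i => ?_, fun h i => ?_⟩
  · simpa using h (π.symm i)
  · exact h (π i)

theorem IsInvariantProcess.configEntropy_star (hν : IsInvariantProcess T ν)
    (hT : IsRegularTree d T) {o : V} (ρ : Fin d ≃ T.neighborSet o) (z : V) :
    configEntropy ν (star T z) = ∑ c, Real.negMulLog (patternProb ν (starEmb ρ) c) := by
  obtain ⟨ρ'⟩ := hT.exists_equiv z
  rw [configEntropy_eq_sum ν (starEmb_injective ρ') (mem_star_iff ρ')]
  simp_rw [hν.patternProb_star hT ρ ρ']

/-- Automorphisms act transitively on ordered edges, so all edges share one marginal. -/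
theorem IsInvariantProcess.configEntropy_edge (hν : IsInvariantProcess T ν)
    (hT : IsRegularTree d T) {o : V} (ρ : Fin d ≃ T.neighborSet o) (i : Fin d) {u w : V}
    (huw : T.Adj u w) :
    configEntropy ν (edge u w) =
      ∑ k : S × S, Real.negMulLog (patternProb ν ![o, ρ i] ![k.1, k.2]) := by
  obtain ⟨ρ', hρ'⟩ := hT.exists_equiv_apply_eq huw i
  have hinj : Function.Injective ![u, w] := by
    intro a b
    fin_cases a <;> fin_cases b <;> simp [huw.ne, huw.ne']
  rw [configEntropy_eq_sum ν hinj (by simp [edge, eq_comm])]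
  refine Fintype.sum_equiv (finTwoArrowEquiv S) _ _ fun c => ?_
  obtain ⟨φ, h0, h⟩ := exists_iso_of_equiv hT ρ ρ'
  rw [← hν.patternProb_comp_iso φ ![o, ρ i]]
  have h1 : φ ∘ ![o, (ρ i : V)] = ![u, w] := by
    funext j
    fin_cases j
    · exact h0
    · exact (h i).trans hρ'
  have h2 : ![(finTwoArrowEquiv S c).1, (finTwoArrowEquiv S c).2] = c := by
    funext j
    fin_cases j <;> rfl
  rw [h1, h2]

/-- The expected number of leaves labelled `b` on the event that the centre is labelled `a`. -/
theorem IsInvariantProcess.sum_patternProb_mul_card (hν : IsInvariantProcess T ν)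
    (hT : IsRegularTree d T) {o : V} (ρ : Fin d ≃ T.neighborSet o) (j : Fin d) (a b : S)
    [DecidableEq S] :
    ∑ c, patternProb ν (starEmb ρ) c *
      (Finset.univ.filter fun i : Fin d => c 0 = a ∧ c i.succ = b).card =
      d * patternProb ν ![o, ρ j] ![a, b] := by
  have := hν.isProbabilityMeasure
  -- By linearity it suffices to treat one leaf `i`; the automorphism exchanging leaves `i` and `j`
  -- makes every term equal.
  have key : ∀ i : Fin d, ∑ c, patternProb ν (starEmb ρ) c *
      (if c 0 = a ∧ c i.succ = b then 1 else 0) = patternProb ν ![o, ρ j] ![a, b] := by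
    intro i
    obtain ⟨φ, h0, h⟩ := exists_iso_of_equiv hT ρ ((Equiv.swap i j).trans ρ)
    have hφ : φ ∘ ![o, (ρ i : V)] = ![o, (ρ j : V)] := by
      funext k
      fin_cases k
      · exact h0
      · exact (h i).trans (by simp)
    rw [← hφ, hν.patternProb_comp_iso]
    have := measureReal_comp_eq_sum ν (starEmb ρ) fun c => c 0 = a ∧ c i.succ = b
    simp only [mul_ite, mul_one, mul_zero]
    rw [← Finset.sum_filter]
    convert this.symm using 1
    unfold patternProb
    congr 1
    ext ω
    simp [funext_iff, Fin.forall_fin_two, starEmb]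
  simp_rw [Finset.card_filter, Nat.cast_sum, Finset.mul_sum]
  rw [Finset.sum_comm]
  push_cast
  simp_rw [key]
  simp

end StarMarginal

/-! ### Counting matchings of typed points -/

section TypedMatchings

variable {X K : Type*} [Fintype X] [DecidableEq X] [DecidableEq K]

/-- The perfect matchings of `A`, as involutions with support `A`, that match points of type `k`
with points of type `τ k`. -/
def typedMatchings (t : X → K) (τ : K → K) (A : Finset X) : Finset (Equiv.Perm X) :=
  {σ | (∀ x, σ (σ x) = x) ∧ (∀ x, σ x ≠ x ↔ x ∈ A) ∧ ∀ x ∈ A, t (σ x) = τ (t x)}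

/-- The number of points of type `k` in `A`. -/
def typeCount (t : X → K) (A : Finset X) (k : K) : ℕ :=
  (A.filter fun x => t x = k).card

theorem mem_typedMatchings {t : X → K} {τ : K → K} {A : Finset X} {σ : Equiv.Perm X} :
    σ ∈ typedMatchings t τ A ↔
      (∀ x, σ (σ x) = x) ∧ (∀ x, σ x ≠ x ↔ x ∈ A) ∧ ∀ x ∈ A, t (σ x) = τ (t x) := by
  simp [typedMatchings]

/-- Multiplying by the swap removes the matched pair `x, σ x` from the matching; this is the
recursion behind the count. -/
theorem mul_swap_mem_typedMatchings {t : X → K} {τ : K → K} {A : Finset X} {σ : Equiv.Perm X}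
    (hσ : σ ∈ typedMatchings t τ A) (x : X) :
    σ * Equiv.swap x (σ x) ∈ typedMatchings t τ ((A.erase x).erase (σ x)) := by
  rw [mem_typedMatchings] at hσ ⊢
  obtain ⟨h1, h2, h3⟩ := hσ
  have key : ∀ z, (σ * Equiv.swap x (σ x)) z = if z = x ∨ z = σ x then z else σ z := by
    intro z
    rw [Equiv.Perm.mul_apply, Equiv.swap_apply_def]
    split_ifs <;> simp_all
  refine ⟨fun z => ?_, fun z => ?_, fun z hz => ?_⟩
  · rw [key z]
    split_ifs with h
    · rw [key, if_pos h]
    · rw [key, h1, ite_eq_right_iff]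
      rintro (h' | h')
      · exact absurd (Or.inr (by rw [← h', h1])) h
      · exact absurd (Or.inl (σ.injective h')) h
  · rw [key]
    simp only [Finset.mem_erase, ← h2 z]
    split_ifs with h
    · simp only [ne_eq, not_true_eq_false, false_iff]
      rintro ⟨h4, h5, -⟩
      exact h.elim h5 h4
    · push Not at h
      simp [h]
  · simp only [Finset.mem_erase] at hz
    rw [key, if_neg (by tauto)]
    exact h3 z hz.2.2

omit [Fintype X] in
theorem typeCount_erase {t : X → K} {A : Finset X} {x : X} (hx : x ∈ A) (k : K) :
    typeCount t A k = typeCount t (A.erase x) k + if t x = k then 1 else 0 := by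
  unfold typeCount
  rw [Finset.filter_erase]
  split_ifs with h
  · rw [Finset.card_erase_add_one (by simp [hx, h])]
  · rw [Finset.erase_eq_of_notMem (by simp [h]), add_zero]

/-- Removing one point of type `k` and one of type `l` divides the product by `N k * N l` if `k ≠
l`, and by `N k * (N k - 1)` if `k = l`. Either number is at least `b ^ 2`, where `b` stands for the
number of partners available to a point of type `k`. -/
theorem sq_mul_prod_factorial_le [Fintype K] {N N' : K → ℕ} {k l : K} {b : ℕ} (hlk : N l ≤ N k)
    (hN : ∀ j, N j = N' j + (if l = j then 1 else 0) + if k = j then 1 else 0)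
    (hb : b + (if k = l then 1 else 0) ≤ N l) :
    b ^ 2 * ∏ j, (N' j).factorial ≤ ∏ j, (N j).factorial := by
  by_cases hkl : k = l
  · subst hkl
    have h1 := hN k
    simp only [if_true] at h1 hb
    rw [← Finset.mul_prod_erase _ _ (Finset.mem_univ k), ← Finset.mul_prod_erase _ (fun j =>
      (N j).factorial) (Finset.mem_univ k), ← mul_assoc]
    refine Nat.mul_le_mul ?_ (Finset.prod_le_prod' fun j hj => ?_)
    · rw [h1, Nat.factorial_succ, Nat.factorial_succ, ← mul_assoc, sq]
      gcongr <;> omega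
    · rw [hN j]
      have : k ≠ j := (Finset.ne_of_mem_erase hj).symm
      simp [this]
  · have h1 := hN k
    have h2 := hN l
    have hlk' : l ≠ k := Ne.symm hkl
    simp only [if_true, hkl, hlk', if_false, add_zero] at h1 h2 hb
    have hl : l ∈ Finset.univ.erase k := by simp [hlk']
    rw [← Finset.mul_prod_erase _ _ (Finset.mem_univ k), ← Finset.mul_prod_erase _ (fun j =>
      (N j).factorial) (Finset.mem_univ k), ← Finset.mul_prod_erase _ _ hl,
      ← Finset.mul_prod_erase _ (fun j => (N j).factorial) hl]
    have h3 : ∏ j ∈ (Finset.univ.erase k).erase l, (N' j).factorial =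
        ∏ j ∈ (Finset.univ.erase k).erase l, (N j).factorial := by
      refine Finset.prod_congr rfl fun j hj => ?_
      simp only [Finset.mem_erase] at hj
      rw [hN j, if_neg (Ne.symm hj.1), if_neg (Ne.symm hj.2.1), add_zero, add_zero]
    rw [h3]
    calc b ^ 2 * ((N' k).factorial * ((N' l).factorial *
          ∏ j ∈ (Finset.univ.erase k).erase l, (N j).factorial))
        = (b * (N' k).factorial) * ((b * (N' l).factorial) *
          ∏ j ∈ (Finset.univ.erase k).erase l, (N j).factorial) := by ring
      _ ≤ ((N k) * (N' k).factorial) * ((N l * (N' l).factorial) *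
          ∏ j ∈ (Finset.univ.erase k).erase l, (N j).factorial) := by
          gcongr
          omega
      _ = _ := by rw [h1, h2, Nat.factorial_succ, Nat.factorial_succ]

/-- Induction on `A`: fix a point, split by its partner, and delete the pair. Squaring allows the
cases `τ k = k` and `τ k ≠ k` to be treated together. -/
theorem card_typedMatchings_sq_le [Fintype K] (t : X → K) {τ : K → K} (hτ : ∀ k, τ (τ k) = k)
    (A : Finset X) :
    (typedMatchings t τ A).card ^ 2 ≤ ∏ k, (typeCount t A k).factorial := by
  induction hn : A.card using Nat.strong_induction_on generalizing A with
  | _ n ih =>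
  rcases A.eq_empty_or_nonempty with rfl | ⟨y, hy⟩
  · have : typedMatchings t τ ∅ ⊆ {1} := by
      intro σ hσ
      rw [Finset.mem_singleton]
      ext x
      have := (mem_typedMatchings.1 hσ).2.1 x
      simpa using this
    have h1 := Finset.card_le_card this
    rw [Finset.card_singleton] at h1
    calc _ ≤ 1 ^ 2 := Nat.pow_le_pow_left h1 2
      _ ≤ _ := by simp [typeCount]
  -- The point is taken from the more frequent of the two paired types, so that its partners lie in
  -- the rarer one and the square of their number is at most the product of both counts.
  · obtain ⟨x, hx, hxN⟩ : ∃ x ∈ A, typeCount t A (τ (t x)) ≤ typeCount t A (t x) := by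
      by_cases h : typeCount t A (τ (t y)) ≤ typeCount t A (t y)
      · exact ⟨y, hy, h⟩
      · obtain ⟨x, hx⟩ := Finset.card_pos.1 (lt_of_le_of_lt (Nat.zero_le _) (not_le.1 h))
        rw [Finset.mem_filter] at hx
        refine ⟨x, hx.1, ?_⟩
        rw [hx.2, hτ]
        exact (not_le.1 h).le
    set B : Finset X := (A.erase x).filter fun y => t y = τ (t x) with hB
    have hmaps : ∀ σ ∈ typedMatchings t τ A, σ x ∈ B := by
      intro σ hσ
      obtain ⟨h1, h2, h3⟩ := mem_typedMatchings.1 hσ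
      have h4 := (h2 x).2 hx
      simp only [hB, Finset.mem_filter, Finset.mem_erase]
      exact ⟨⟨h4, (h2 _).1 fun h => h4 (σ.injective h)⟩, h3 x hx⟩
    have hfib : ∀ y ∈ B, ((typedMatchings t τ A).filter fun σ => σ x = y).card ≤
        (typedMatchings t τ ((A.erase x).erase y)).card := by
      intro y _
      refine Finset.card_le_card_of_injOn (fun σ => σ * Equiv.swap x y) ?_ ?_
      · intro σ hσ
        simp only [Finset.coe_filter, Set.mem_ofPred_eq] at hσ
        obtain ⟨hσ, rfl⟩ := hσ
        exact mul_swap_mem_typedMatchings hσ x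
      · intro σ _ σ' _ h
        exact mul_right_cancel h
    have hsum : (typedMatchings t τ A).card ≤
        ∑ y ∈ B, (typedMatchings t τ ((A.erase x).erase y)).card := by
      rw [Finset.card_eq_sum_card_fiberwise hmaps]
      exact Finset.sum_le_sum hfib
    have hQ : ∀ y ∈ B, B.card ^ 2 * (typedMatchings t τ ((A.erase x).erase y)).card ^ 2 ≤
        ∏ k, (typeCount t A k).factorial := by
      intro y hyB
      simp only [hB, Finset.mem_filter] at hyB
      have hcard : ((A.erase x).erase y).card < n := by
        rw [← hn]
        exact (Finset.card_erase_lt_of_mem hyB.1).trans (Finset.card_erase_lt_of_mem hx)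
      refine (Nat.mul_le_mul_left _ (ih _ hcard _ rfl)).trans
        (sq_mul_prod_factorial_le hxN (fun j => ?_) ?_)
      · rw [typeCount_erase hx, typeCount_erase hyB.1, hyB.2]
      · rw [typeCount_erase hx]
        rfl
    rcases B.eq_empty_or_nonempty with hBe | hBe
    · rw [hBe, Finset.sum_empty, Nat.le_zero] at hsum
      simp [hsum]
    · refine (Nat.pow_le_pow_left hsum 2).trans ?_
      -- Cauchy–Schwarz; a further factor `B.card` then gives each summand the `B.card ^ 2` required
      -- by `hQ`.
      refine (sq_sum_le_card_mul_sum_sq (s := B)).trans ?_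
      refine Nat.le_of_mul_le_mul_left ?_ (Finset.card_pos.2 hBe)
      calc _ = ∑ y ∈ B, B.card ^ 2 * (typedMatchings t τ ((A.erase x).erase y)).card ^ 2 := by
            rw [← mul_assoc, Nat.cast_id, ← sq, Finset.mul_sum]
        _ ≤ ∑ y ∈ B, ∏ k, (typeCount t A k).factorial := Finset.sum_le_sum hQ
        _ = _ := by simp

end TypedMatchings

/-! ### A lower bound for the number of regular graphs -/

section Sequences

open Classical in
/-- Greedy choice: the number of sequences of pairwise compatible elements. -/
theorem pow_le_card_pairwise {D : Type*} [Fintype D] (conf : D → D → Prop)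
    (hs : ∀ x y, conf x y → conf y x) {B : ℕ}
    (hB : ∀ x, (Finset.univ.filter fun y => conf x y).card ≤ B) (k : ℕ) :
    (Fintype.card D - k * B) ^ k ≤
      (Finset.univ.filter fun s : Fin k → D => ∀ i j, i ≠ j → ¬ conf (s i) (s j)).card := by
  induction k with
  | zero => simp
  | succ k ih =>
    set P := Finset.univ.filter fun s : Fin k → D => ∀ i j, i ≠ j → ¬ conf (s i) (s j)
    let free : (Fin k → D) → Finset D := fun s => Finset.univ.filter fun y => ∀ i, ¬ conf (s i) y
    have hfree : ∀ s, Fintype.card D - k * B ≤ (free s).card := by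
      intro s
      have h1 : (free s)ᶜ ⊆ Finset.univ.biUnion fun i : Fin k =>
          Finset.univ.filter fun y => conf (s i) y := by
        intro y hy
        simpa [free] using hy
      have h2 := (Finset.card_le_card h1).trans Finset.card_biUnion_le
      have h3 : ∑ i : Fin k, (Finset.univ.filter fun y => conf (s i) y).card ≤ k * B := by
        calc _ ≤ ∑ _i : Fin k, B := Finset.sum_le_sum fun i _ => hB (s i)
          _ = k * B := by simp
      rw [Finset.card_compl] at h2
      omega
    calc (Fintype.card D - (k + 1) * B) ^ (k + 1)
        ≤ (Fintype.card D - k * B) ^ k * (Fintype.card D - k * B) := by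
          rw [← pow_succ]
          gcongr
          omega
      _ ≤ P.card * (Fintype.card D - k * B) := Nat.mul_le_mul_right _ ih
      _ ≤ ∑ s ∈ P, (free s).card := by
          rw [← smul_eq_mul]
          exact Finset.card_nsmul_le_sum _ _ _ fun s _ => hfree s
      _ = (P.sigma free).card := (Finset.card_sigma _ _).symm
      _ ≤ _ := by
          refine Finset.card_le_card_of_injOn (fun p => Fin.cons p.2 p.1) ?_ ?_
          · rintro ⟨s, y⟩ h
            simp only [Finset.coe_sigma, Set.mem_sigma_iff, Finset.mem_coe, P, free,
              Finset.mem_filter, Finset.mem_univ, true_and] at h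
            simp only [Finset.coe_filter, Finset.mem_univ, true_and, Set.mem_ofPred_eq]
            intro i j
            refine Fin.cases ?_ (fun i => ?_) i <;> refine Fin.cases ?_ (fun j => ?_) j
            · simp
            · intro _ h'
              exact h.2 j (hs _ _ h')
            · intro _
              exact h.2 i
            · intro hij
              exact h.1 i j fun h => hij (h ▸ rfl)
          · rintro ⟨s, y⟩ _ ⟨s', y'⟩ _ h
            obtain ⟨rfl, rfl⟩ := Fin.cons_injective2 h
            rfl

open Classical in
/-- The number of injective sequences exhausting a finite set. -/
theorem card_injective_mem {W : Type*} [Fintype W] {N : Set W} {d : ℕ} (hN : N.ncard = d) :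
    (Finset.univ.filter fun a : Fin d → W => Function.Injective a ∧ ∀ i, a i ∈ N).card =
      d.factorial := by
  rw [← Fintype.card_subtype]
  let e : {a : Fin d → W // Function.Injective a ∧ ∀ i, a i ∈ N} ≃ (Fin d ↪ N) :=
    { toFun := fun a => ⟨fun i => ⟨a.1 i, a.2.2 i⟩, fun i j h => a.2.1 (Subtype.ext_iff.1 h)⟩
      invFun := fun a => ⟨fun i => a i, Subtype.val_injective.comp a.injective, fun i => (a i).2⟩
      left_inv := fun a => rfl
      right_inv := fun a => rfl }
  rw [Fintype.card_congr e, Fintype.card_embedding_eq, Fintype.card_fin, ← Nat.card_eq_fintype_card,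
    Nat.card_coe_set_eq, hN, Nat.descFactorial_self]

end Sequences

/-! ### Growth of the number of regular graphs under insertion of two vertices -/

section Insertion

variable {V : Type*}

open Classical in
/-- The `d`-regular graphs on a finite vertex set. -/
def regFinset (d : ℕ) (V : Type*) [Fintype V] : Finset (SimpleGraph V) :=
  Finset.univ.filter fun G => ∀ v, (G.neighborSet v).ncard = d

theorem mem_regFinset {d : ℕ} [Fintype V] {G : SimpleGraph V} :
    G ∈ regFinset d V ↔ ∀ v, (G.neighborSet v).ncard = d := by
  simp [regFinset]

open Classical in
theorem degree_eq_ncard [Fintype V] (G : SimpleGraph V) (v : V) :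
    G.degree v = (G.neighborSet v).ncard := by
  rw [Set.ncard_eq_toFinset_card', Set.toFinset_card, SimpleGraph.card_neighborSet_eq_degree]

theorem coe_regFinset (d n : ℕ) : (regFinset d (Fin n) : Set (SimpleGraph (Fin n))) =
    regularGraphs d n := by
  classical
  ext G
  simp only [Finset.mem_coe, mem_regFinset, regularGraphs, Set.mem_ofPred_eq,
    SimpleGraph.IsRegularOfDegree]
  refine forall_congr' fun v => ?_
  rw [← degree_eq_ncard]

theorem card_regFinset_le (d : ℕ) {W : Type*} [Fintype V] [Fintype W] (e : V ≃ W) :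
    (regFinset d V).card ≤ (regFinset d W).card := by
  refine Finset.card_le_card_of_injOn e.simpleGraph (fun G hG => ?_) e.simpleGraph.injective.injOn
  rw [Finset.mem_coe, mem_regFinset] at hG ⊢
  intro w
  rw [← hG (e.symm w)]
  have : (e.simpleGraph G).neighborSet w = e '' G.neighborSet (e.symm w) := by
    ext x
    simp [Equiv.simpleGraph, SimpleGraph.comap_adj, e.image_eq_preimage_symm]
  rw [this, Set.ncard_image_of_injective _ e.injective]

theorem card_regFinset_congr (d : ℕ) {W : Type*} [Fintype V] [Fintype W] (e : V ≃ W) :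
    (regFinset d V).card = (regFinset d W).card :=
  le_antisymm (card_regFinset_le d e) (card_regFinset_le d e.symm)

/-- Subdivide the edges `a i b i` of `G`, identifying the subdividing vertices next to the `a i`
with one new vertex `x` and those next to the `b i` with a second new vertex `y`, and delete the
edges joining `x` and `y`. -/
def insertTwo {ι : Type*} (G : SimpleGraph V) (a b : ι → V) : SimpleGraph (V ⊕ Bool) where
  Adj
  | .inl v, .inl w => G.Adj v w ∧ ∀ i, s(v, w) ≠ s(a i, b i)
  | .inl v, .inr x => v ∈ Set.range (cond x b a)
  | .inr x, .inl v => v ∈ Set.range (cond x b a)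
  | .inr _, .inr _ => False
  symm := ⟨by
    rintro (v | x) (w | y) h
    · exact ⟨h.1.symm, fun i => Sym2.eq_swap (a := v) (b := w) ▸ h.2 i⟩
    · exact h
    · exact h
    · exact h⟩
  loopless := ⟨by
    rintro (v | x) h
    · exact h.1.ne rfl
    · exact h⟩

/-- Since the `2 d` endpoints are distinct, each loses exactly one neighbour and gains exactly one
new vertex, while each new vertex receives `d` neighbours. -/
theorem ncard_neighborSet_insertTwo [Finite V] {d : ℕ} {G : SimpleGraph V} {a b : Fin d → V}
    (hG : ∀ v, (G.neighborSet v).ncard = d) (ha : Function.Injective a)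
    (hb : Function.Injective b) (hab : ∀ i j, a i ≠ b j) (hadj : ∀ i, G.Adj (a i) (b i))
    (z : V ⊕ Bool) : ((insertTwo G a b).neighborSet z).ncard = d := by
  have hinr : ∀ (x : Bool) (c : Fin d → V), Function.Injective c → cond x b a = c →
      ((insertTwo G a b).neighborSet (.inr x)).ncard = d := by
    rintro x c hc rfl
    have : (insertTwo G a b).neighborSet (.inr x) = Sum.inl '' Set.range (cond x b a) := by
      ext (v | y)
      · simp [insertTwo]
      · simp [insertTwo]
    rw [this, Set.ncard_image_of_injective _ Sum.inl_injective, ← Set.image_univ,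
      Set.ncard_image_of_injective _ hc, Set.ncard_univ, Nat.card_eq_fintype_card, Fintype.card_fin]
  have hend : ∀ (v w : V) (x : Bool), G.Adj v w → v ∈ Set.range (cond x b a) →
      v ∉ Set.range (cond (!x) b a) → (∀ w', (∀ i, s(v, w') ≠ s(a i, b i)) ↔ w' ≠ w) →
      ((insertTwo G a b).neighborSet (.inl v)).ncard = d := by
    intro v w x hvw h1 h2 h3
    have : (insertTwo G a b).neighborSet (.inl v) =
        insert (.inr x) (Sum.inl '' (G.neighborSet v \ {w})) := by
      ext (w' | y)
      · have : (insertTwo G a b).Adj (.inl v) (.inl w') ↔ G.Adj v w' ∧ w' ≠ w :=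
          and_congr_right fun _ => h3 w'
        simpa using this
      · have : (insertTwo G a b).Adj (.inl v) (.inr y) ↔ v ∈ Set.range (cond y b a) := Iff.rfl
        rw [SimpleGraph.mem_neighborSet, this]
        rcases Bool.eq_or_eq_not y x with rfl | rfl
        · exact iff_of_true h1 (Set.mem_insert _ _)
        · exact iff_of_false h2 (by simp)
    rw [this, Set.ncard_insert_of_notMem (by simp), Set.ncard_image_of_injective _ Sum.inl_injective,
      Set.ncard_sdiff_singleton_add_one (show w ∈ G.neighborSet v from hvw), hG]
  rcases z with v | x
  · by_cases hva : v ∈ Set.range a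
    · obtain ⟨i, rfl⟩ := hva
      refine hend _ (b i) false (hadj i) ⟨i, rfl⟩ ?_ fun w' => ⟨fun h h' => ?_, fun h j h' => ?_⟩
      · rintro ⟨j, hj⟩
        exact hab i j hj.symm
      · exact h i (by rw [h'])
      · rcases Sym2.eq_iff.1 h' with ⟨h1, h2⟩ | ⟨h1, h2⟩
        · exact h (by rw [h2, ha h1])
        · exact hab _ _ h1
    · by_cases hvb : v ∈ Set.range b
      · obtain ⟨i, rfl⟩ := hvb
        refine hend _ (a i) true (hadj i).symm ⟨i, rfl⟩ hva fun w' => ⟨fun h h' => ?_, fun h j h' => ?_⟩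
        · exact h i (by rw [h', Sym2.eq_swap])
        · rcases Sym2.eq_iff.1 h' with ⟨h1, h2⟩ | ⟨h1, h2⟩
          · exact hab _ _ h1.symm
          · exact h (by rw [h2, hb h1])
      · have : (insertTwo G a b).neighborSet (.inl v) = Sum.inl '' G.neighborSet v := by
          ext (w | y)
          · simp only [insertTwo, SimpleGraph.mem_neighborSet, Set.mem_image, Sum.inl.injEq,
              exists_eq_right, and_iff_left_iff_imp]
            intro _ i h'
            rcases Sym2.eq_iff.1 h' with ⟨h1, h2⟩ | ⟨h1, h2⟩
            · exact hva ⟨i, h1.symm⟩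
            · exact hvb ⟨i, h1.symm⟩
          · cases y
            · simpa [insertTwo] using hva
            · simpa [insertTwo] using hvb
        rw [this, Set.ncard_image_of_injective _ Sum.inl_injective, hG]
  · cases x
    · exact hinr false a ha rfl
    · exact hinr true b hb rfl

theorem eq_of_insertTwo_eq {ι : Type*} {G H : SimpleGraph V} {a b : ι → V}
    (hG : ∀ i, G.Adj (a i) (b i)) (hH : ∀ i, H.Adj (a i) (b i))
    (h : insertTwo G a b = insertTwo H a b) : G = H := by
  have key : ∀ {G : SimpleGraph V}, (∀ i, G.Adj (a i) (b i)) → ∀ v w,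
      G.Adj v w ↔ (insertTwo G a b).Adj (.inl v) (.inl w) ∨ ∃ i, s(v, w) = s(a i, b i) := by
    intro G hG v w
    constructor
    · intro h
      by_cases h' : ∃ i, s(v, w) = s(a i, b i)
      · exact Or.inr h'
      · exact Or.inl ⟨h, fun i hi => h' ⟨i, hi⟩⟩
    · rintro (h | ⟨i, hi⟩)
      · exact h.1
      · have := hG i
        rwa [← SimpleGraph.mem_edgeSet, ← hi, SimpleGraph.mem_edgeSet] at this
  ext v w
  rw [key hG, key hH, h]

-- Greedy choice of `d` darts without common endpoints: a dart conflicts with at most `4 d` darts,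
-- namely `d` for each choice of an endpoint of either dart, out of `d * card V` darts.
open Classical in
theorem card_disjoint_darts [Fintype V] {d : ℕ} {G : SimpleGraph V}
    (hG : ∀ v, (G.neighborSet v).ncard = d) :
    (d * Fintype.card V - 4 * d ^ 2) ^ d ≤
      (Finset.univ.filter fun p : (Fin d → V) × (Fin d → V) =>
        Function.Injective p.1 ∧ Function.Injective p.2 ∧ (∀ i j, p.1 i ≠ p.2 j) ∧
          ∀ i, G.Adj (p.1 i) (p.2 i)).card := by
  have hdeg : ∀ v, G.degree v = d := fun v => (degree_eq_ncard G v).trans (hG v)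
  let conf : G.Dart → G.Dart → Prop := fun p q =>
    (p.fst = q.fst ∨ p.snd = q.fst) ∨ (p.fst = q.snd ∨ p.snd = q.snd)
  have hfst : ∀ v, (Finset.univ.filter fun q : G.Dart => v = q.fst).card = d := by
    intro v
    rw [← hdeg v, ← G.dart_fst_fiber_card_eq_degree]
    simp_rw [eq_comm]
  have hsnd : ∀ v, (Finset.univ.filter fun q : G.Dart => v = q.snd).card = d := by
    intro v
    rw [← hfst v]
    refine Finset.card_bij' (fun q _ => q.symm) (fun q _ => q.symm) ?_ ?_ ?_ ?_ <;> simp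
  have hB : ∀ p, (Finset.univ.filter fun q => conf p q).card ≤ 4 * d := by
    intro p
    simp only [conf]
    rw [Finset.filter_or, Finset.filter_or, Finset.filter_or]
    refine (Finset.card_union_le _ _).trans ?_
    have h1 := Finset.card_union_le (Finset.univ.filter fun q : G.Dart => p.fst = q.fst)
      (Finset.univ.filter fun q : G.Dart => p.snd = q.fst)
    have h2 := Finset.card_union_le (Finset.univ.filter fun q : G.Dart => p.fst = q.snd)
      (Finset.univ.filter fun q : G.Dart => p.snd = q.snd)
    rw [hfst, hfst] at h1
    rw [hsnd, hsnd] at h2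
    omega
  have h := pow_le_card_pairwise conf (by simp only [conf]; tauto)
    (fun p => by convert hB p) d
  have hcard : Fintype.card G.Dart = d * Fintype.card V := by
    rw [G.dart_card_eq_sum_degrees, Finset.sum_congr rfl fun v _ => hdeg v]
    simp [mul_comm]
  rw [hcard, show d * (4 * d) = 4 * d ^ 2 by ring] at h
  refine h.trans (Finset.card_le_card_of_injOn
    (fun s => (fun i => (s i).fst, fun i => (s i).snd)) ?_ ?_)
  · intro s hs
    simp only [Finset.coe_filter, Finset.mem_univ, true_and, Set.mem_ofPred_eq, conf] at hs ⊢
    refine ⟨fun i j hij => ?_, fun i j hij => ?_, fun i j hij => ?_, fun i => (s i).adj⟩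
    · by_contra hne
      exact hs i j hne (Or.inl (Or.inl hij))
    · by_contra hne
      exact hs i j hne (Or.inr (Or.inr hij))
    · by_cases hne : i = j
      · subst hne
        exact (s i).adj.ne hij
      · exact hs i j hne (Or.inr (Or.inl hij))
  · intro s _ s' _ h
    funext i
    have h1 := congrFun (congrArg Prod.fst h) i
    have h2 := congrFun (congrArg Prod.snd h) i
    exact SimpleGraph.Dart.ext _ _ (Prod.ext h1 h2)

-- Double counting of insertions. From the new graph and the pair `a, b` the old graph is recovered;
-- `a` and `b` enumerate the neighbourhoods of the two new vertices, so each new graph arises at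
-- most `d! ^ 2` times.
open Classical in
theorem card_regFinset_mul_le [Fintype V] (d : ℕ) :
    (regFinset d V).card * (d * Fintype.card V - 4 * d ^ 2) ^ d ≤
      (regFinset d (V ⊕ Bool)).card * d.factorial ^ 2 := by
  let P : SimpleGraph V → Finset ((Fin d → V) × (Fin d → V)) := fun G =>
    Finset.univ.filter fun p => Function.Injective p.1 ∧ Function.Injective p.2 ∧
      (∀ i j, p.1 i ≠ p.2 j) ∧ ∀ i, G.Adj (p.1 i) (p.2 i)
  let N : SimpleGraph (V ⊕ Bool) → Bool → Finset (Fin d → V ⊕ Bool) := fun G x =>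
    Finset.univ.filter fun a => Function.Injective a ∧ ∀ i, a i ∈ G.neighborSet (.inr x)
  calc _ ≤ ∑ G ∈ regFinset d V, (P G).card := by
        rw [← smul_eq_mul]
        exact Finset.card_nsmul_le_sum _ _ _ fun G hG => card_disjoint_darts (mem_regFinset.1 hG)
    _ = ((regFinset d V).sigma P).card := (Finset.card_sigma _ _).symm
    _ ≤ ((regFinset d (V ⊕ Bool)).sigma fun G => N G false ×ˢ N G true).card := by
        refine Finset.card_le_card_of_injOn
          (fun q => ⟨insertTwo q.1 q.2.1 q.2.2, (Sum.inl ∘ q.2.1, Sum.inl ∘ q.2.2)⟩) ?_ ?_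
        · rintro ⟨G, a, b⟩ h
          simp only [Finset.coe_sigma, Set.mem_sigma_iff, Finset.mem_coe, mem_regFinset, P,
            Finset.mem_filter, Finset.mem_univ, true_and] at h
          obtain ⟨hG, ha, hb, hab, hadj⟩ := h
          simp only [Finset.coe_sigma, Set.mem_sigma_iff, Finset.mem_coe, mem_regFinset, N,
            Finset.mem_filter, Finset.mem_univ, true_and, Finset.mem_product]
          exact ⟨ncard_neighborSet_insertTwo hG ha hb hab hadj,
            ⟨Sum.inl_injective.comp ha, fun i => ⟨i, rfl⟩⟩,
            ⟨Sum.inl_injective.comp hb, fun i => ⟨i, rfl⟩⟩⟩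
        · rintro ⟨G, a, b⟩ h ⟨G', a', b'⟩ h' heq
          simp only [Finset.coe_sigma, Set.mem_sigma_iff, Finset.mem_coe, P,
            Finset.mem_filter, Finset.mem_univ, true_and] at h h'
          simp only [Sigma.mk.injEq, heq_eq_eq, Prod.mk.injEq] at heq
          obtain ⟨h1, h2, h3⟩ := heq
          obtain rfl := Sum.inl_injective.comp_left h2
          obtain rfl := Sum.inl_injective.comp_left h3
          obtain rfl := eq_of_insertTwo_eq h.2.2.2.2 h'.2.2.2.2 h1
          rfl
    _ = ∑ G ∈ regFinset d (V ⊕ Bool), d.factorial ^ 2 := by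
        rw [Finset.card_sigma]
        refine Finset.sum_congr rfl fun G hG => ?_
        rw [Finset.card_product, sq]
        congr 1 <;> convert card_injective_mem (mem_regFinset.1 hG _)
    _ = _ := by simp

end Insertion

/-! ### The exponential order of the number of ported graphs -/

section LowerBound

/-- The number of `d`-regular graphs on `n` vertices with an enumeration of every neighbourhood. -/
def numPorted (d n : ℕ) : ℕ := (regFinset d (Fin n)).card * d.factorial ^ n

/-- The overcount `d! ^ 2` is exactly the number of portings of the two new vertices. -/
theorem numPorted_mul_le (d n : ℕ) :
    numPorted d n * (d * n - 4 * d ^ 2) ^ d ≤ numPorted d (n + 2) := by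
  have h := card_regFinset_mul_le (V := Fin n) d
  rw [card_regFinset_congr d (Fintype.equivFinOfCardEq (by simp) : Fin n ⊕ Bool ≃ Fin (n + 2)),
    Fintype.card_fin] at h
  calc _ = ((regFinset d (Fin n)).card * (d * n - 4 * d ^ 2) ^ d) * d.factorial ^ n := by
        unfold numPorted
        ring
    _ ≤ _ := Nat.mul_le_mul_right _ h
    _ = _ := by
        unfold numPorted
        ring

/-- A mean value bound: `x log x - x` has derivative `log x`. It controls the increase of the target
when two vertices are added. -/
theorem mul_log_sub_le {M t : ℝ} (hM : 0 < M) (ht : 0 ≤ t) :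
    ((M + t) * Real.log (M + t) - (M + t)) - (M * Real.log M - M) ≤ t * Real.log (M + t) := by
  have h := Real.log_le_sub_one_of_pos (div_pos (add_pos_of_pos_of_nonneg hM ht) hM)
  rw [Real.log_div (by positivity) hM.ne'] at h
  have h2 : (M + t) / M - 1 = t / M := by field_simp; ring
  rw [h2, le_div_iff₀ hM] at h
  linarith

/-- If the number of `d`-regular graphs on `m` vertices is positive, then it is large on `m + 2 j`
vertices. -/
theorem exists_numPorted_lower_bound_of_pos {d : ℕ} (hd : 0 < d) {δ : ℝ} (hδ : 0 < δ) :
    ∃ N : ℕ, ∀ m ≥ N, 0 < numPorted d m → ∃ C : ℝ, ∀ j : ℕ, 0 < numPorted d (m + 2 * j) ∧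
      ((d * (m + 2 * j : ℕ) : ℝ) * Real.log (d * (m + 2 * j : ℕ)) - d * (m + 2 * j : ℕ)) / 2 -
        δ * (m + 2 * j : ℕ) - C ≤ Real.log (numPorted d (m + 2 * j)) := by
  -- This makes `d n - 4 d ^ 2` positive and at least `d (4 d ^ 2 + 2 d) / δ`. Replacing `log (d n +
  -- 2 d)` by `log (d n - 4 d ^ 2)` then costs at most `δ` per insertion, within the allowance `2
  -- δ`.
  obtain ⟨N, hN⟩ := exists_nat_ge (4 * (d : ℝ) + 1 + d * (4 * d ^ 2 + 2 * d) / δ)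
  refine ⟨N, fun m hm hpos => ⟨((d * m : ℝ) * Real.log (d * m) - d * m) / 2 - δ * m -
    Real.log (numPorted d m), fun j => ?_⟩⟩
  induction j with
  | zero =>
    refine ⟨hpos, ?_⟩
    simp
  | succ j ih =>
    obtain ⟨ih1, ih2⟩ := ih
    set n := m + 2 * j with hn
    have hn2 : m + 2 * (j + 1) = n + 2 := by omega
    rw [hn2]
    have hnN : (N : ℝ) ≤ n := by exact_mod_cast hm.trans (by omega)
    have hd' : (1 : ℝ) ≤ d := by exact_mod_cast hd
    have hq : 0 ≤ d * (4 * (d : ℝ) ^ 2 + 2 * d) / δ := by positivity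
    have hbig : d * (4 * (d : ℝ) ^ 2 + 2 * d) / δ + 1 ≤ d * n - 4 * d ^ 2 := by
      have h1 : 1 + d * (4 * (d : ℝ) ^ 2 + 2 * d) / δ ≤ n - 4 * d := by linarith
      calc _ ≤ 1 * (n - 4 * (d : ℝ)) := by linarith
        _ ≤ d * (n - 4 * (d : ℝ)) := by gcongr; linarith
        _ = _ := by ring
    have hcast : ((d * n - 4 * d ^ 2 : ℕ) : ℝ) = d * n - 4 * d ^ 2 := by
      have : 4 * d ^ 2 ≤ d * n := by
        have : (4 * (d : ℝ) ^ 2) ≤ d * n := by linarith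
        exact_mod_cast this
      push_cast [Nat.cast_sub this]
      ring
    have hstep := numPorted_mul_le d n
    have hy : (0 : ℝ) < d * n - 4 * d ^ 2 := by linarith
    have hy' : 0 < d * n - 4 * d ^ 2 := by
      have : (0 : ℝ) < ((d * n - 4 * d ^ 2 : ℕ) : ℝ) := by rwa [hcast]
      exact_mod_cast this
    have hpos' : 0 < numPorted d (n + 2) := lt_of_lt_of_le (by positivity) hstep
    refine ⟨hpos', ?_⟩
    have hlog : Real.log (numPorted d n) + d * Real.log (d * n - 4 * d ^ 2) ≤
        Real.log (numPorted d (n + 2)) := by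
      rw [← hcast, ← Real.log_pow, ← Real.log_mul (by positivity) (by positivity)]
      refine Real.log_le_log (by positivity) ?_
      exact_mod_cast hstep
    have hM : (0 : ℝ) < d * n := by
      have : 0 ≤ 4 * (d : ℝ) ^ 2 := by positivity
      linarith
    have hφ := mul_log_sub_le hM (t := 2 * d) (by positivity)
    have hratio : Real.log (d * n + 2 * d) - Real.log (d * n - 4 * d ^ 2) ≤
        (4 * (d : ℝ) ^ 2 + 2 * d) / (d * n - 4 * d ^ 2) := by
      rw [← Real.log_div (by positivity) hy.ne']
      refine (Real.log_le_sub_one_of_pos (by positivity)).trans (le_of_eq ?_)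
      rw [div_sub_one hy.ne']
      ring
    have hratio2 : d * ((4 * (d : ℝ) ^ 2 + 2 * d) / (d * n - 4 * d ^ 2)) ≤ δ := by
      rw [← mul_div_assoc, div_le_iff₀ hy]
      have : d * (4 * (d : ℝ) ^ 2 + 2 * d) / δ ≤ d * n - 4 * d ^ 2 := by linarith
      rw [div_le_iff₀ hδ] at this
      linarith
    have hratio3 := (mul_le_mul_of_nonneg_left hratio (by positivity : (0 : ℝ) ≤ d)).trans hratio2
    have hM2 : (d : ℝ) * (n + 2 : ℕ) = d * n + 2 * d := by push_cast; ring
    have hδ2 : δ * ((n + 2 : ℕ) : ℝ) = δ * n + 2 * δ := by push_cast; ring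
    rw [hM2, hδ2]
    linarith

/-- Up to a subexponential factor, the number of `d`-regular graphs on `n` vertices with an
enumeration of every neighbourhood is at least the number of matchings of `d n` points. -/
theorem exists_numPorted_lower_bound {d : ℕ} (hd : 0 < d) {δ : ℝ} (hδ : 0 < δ) :
    ∃ N : ℕ, ∃ C : ℝ, ∀ n ≥ N, 0 < numPorted d n →
      ((d * n : ℝ) * Real.log (d * n) - d * n) / 2 - δ * n - C ≤ Real.log (numPorted d n) := by
  obtain ⟨N, hN⟩ := exists_numPorted_lower_bound_of_pos hd hδ
  -- Insertion preserves the parity of `n`, so each parity class starts from its own least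
  -- admissible `n ≥ N`, with its own constant.
  have key : ∀ r : ℕ, ∃ C : ℝ, ∀ n ≥ N, n % 2 = r → 0 < numPorted d n →
      ((d * n : ℝ) * Real.log (d * n) - d * n) / 2 - δ * n - C ≤ Real.log (numPorted d n) := by
    intro r
    by_cases h : ∃ m, N ≤ m ∧ m % 2 = r ∧ 0 < numPorted d m
    · classical
      obtain ⟨h1, h2, h3⟩ := Nat.find_spec h
      obtain ⟨C, hC⟩ := hN _ h1 h3
      refine ⟨C, fun n hn hr hpos => ?_⟩
      have hle : Nat.find h ≤ n := Nat.find_min' h ⟨hn, hr, hpos⟩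
      have := (hC ((n - Nat.find h) / 2)).2
      rwa [show Nat.find h + 2 * ((n - Nat.find h) / 2) = n by omega] at this
    · exact ⟨0, fun n hn hr hpos => absurd ⟨n, hn, hr, hpos⟩ h⟩
  choose C hC using key
  refine ⟨N, max (C 0) (C 1), fun n hn hpos => ?_⟩
  have h0 := le_max_left (C 0) (C 1)
  have h1 := le_max_right (C 0) (C 1)
  rcases Nat.mod_two_eq_zero_or_one n with h | h
  · have := hC 0 n hn h hpos
    linarith
  · have := hC 1 n hn h hpos
    linarith

end LowerBound

/-! ### Coloured graphs as labelled matchings -/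

section Ports

variable {V S : Type*} {d : ℕ}

/-- The star with centre `0` and `d` leaves. -/
def starGraph (d : ℕ) : SimpleGraph (Fin (d + 1)) where
  Adj x y := x ≠ y ∧ (x = 0 ∨ y = 0)
  symm := ⟨fun _ _ h => ⟨h.1.symm, h.2.symm⟩⟩
  loopless := ⟨fun _ h => h.1 rfl⟩

/-- The labels of a vertex and of its neighbours, in the order given by `P`. -/
def starLabel (f : V → S) (P : V → Fin d → V) (v : V) : Fin (d + 1) → S :=
  Fin.cons (f v) (f ∘ P v)

/-- The type of the `i`-th half-edge at `v`: the label of `v`, and of its `i`-th neighbour. -/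
def halfEdgeType (σ : V → Fin (d + 1) → S) (x : V × Fin d) : S × S :=
  (σ x.1 0, σ x.1 x.2.succ)

theorem mem_closedBall_one {G : SimpleGraph V} {v u : V} :
    u ∈ closedBall G v 1 ↔ G.Adj v u ∨ v = u :=
  SimpleGraph.edist_le_one_iff_adj_or_eq

/-- The isomorphism induces an injection of the leaf indices, hence a permutation. Only its root and
colours matter, so `W` is arbitrary. -/
theorem sameStar_starLabel {W : SimpleGraph (Fin (d + 1))} {G : SimpleGraph V} {f : V → S} {v : V}
    {c : Fin (d + 1) → S} (h : NbhdIso G f v 1 W c 0) {P : V → Fin d → V}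
    (hinj : Function.Injective (P v)) (hadj : ∀ i, G.Adj v (P v i)) :
    SameStar c (starLabel f P v) := by
  obtain ⟨φ, h0, hc⟩ := h
  let u : Fin d → closedBall G v 1 := fun i => ⟨P v i, mem_closedBall_one.2 (Or.inl (hadj i))⟩
  have hu : ∀ i, φ (u i) ≠ 0 := by
    intro i hi
    have h := φ.injective (hi.trans h0.symm)
    exact (hadj i).ne (Subtype.ext_iff.1 h).symm
  let π : Fin d → Fin d := fun i => (φ (u i)).pred (hu i)
  have hπ : Function.Injective π := by
    intro i j hij
    have h := φ.injective (Fin.pred_inj.1 hij)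
    exact hinj (Subtype.ext_iff.1 h)
  refine ⟨?_, Equiv.ofBijective π (Finite.injective_iff_bijective.1 hπ), fun i => ?_⟩
  · have := hc ⟨v, center_mem_closedBall G v 1⟩
    rw [h0] at this
    exact this.symm
  · simp only [Equiv.ofBijective_apply, π, Fin.succ_pred, hc]
    rfl

/-- Acyclicity forbids edges between leaves, so the ball of radius one is a star. -/
theorem nbhdIso_of_sameStar {T : SimpleGraph V} (hT : T.IsAcyclic) {o : V}
    (ρ : Fin d ≃ T.neighborSet o) {ω : V → S} {c : Fin (d + 1) → S}
    (h : SameStar c (ω ∘ starEmb ρ)) : NbhdIso T ω o 1 (starGraph d) c 0 := by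
  obtain ⟨h0, π, hπ⟩ := h
  let ρ' : Fin d ≃ T.neighborSet o := π.symm.trans ρ
  have hmem : ∀ i, starEmb ρ' i ∈ closedBall T o 1 := by
    intro i
    rw [mem_closedBall_one]
    refine Fin.cases (Or.inr rfl) (fun i => Or.inl (ρ' i).2) i
  have hbij : Function.Bijective fun i => (⟨starEmb ρ' i, hmem i⟩ : closedBall T o 1) := by
    refine ⟨fun i j hij => starEmb_injective ρ' (Subtype.ext_iff.1 hij), ?_⟩
    rintro ⟨v, hv⟩
    rcases mem_closedBall_one.1 hv with h | rfl
    · exact ⟨(ρ'.symm ⟨v, h⟩).succ, Subtype.ext (by simp)⟩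
    · exact ⟨0, rfl⟩
  have hntri : ∀ i j, ¬ T.Adj (ρ' i) (ρ' j) := by
    classical
    intro i j hij
    refine hT.cliqueFree le_rfl {o, (ρ' i : V), (ρ' j : V)} ?_
    exact SimpleGraph.is3Clique_triple_iff.2 ⟨(ρ' i).2, (ρ' j).2, hij⟩
  let ψ : starGraph d ≃g T.induce (closedBall T o 1) :=
    ⟨Equiv.ofBijective _ hbij, by
      intro i j
      change T.Adj (starEmb ρ' i) (starEmb ρ' j) ↔ i ≠ j ∧ (i = 0 ∨ j = 0)
      refine Fin.cases ?_ (fun i => ?_) i <;> refine Fin.cases ?_ (fun j => ?_) j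
      · simp
      · exact iff_of_true (ρ' j).2 ⟨(Fin.succ_ne_zero j).symm, Or.inl rfl⟩
      · exact iff_of_true (SimpleGraph.Adj.symm (ρ' i).2) ⟨Fin.succ_ne_zero i, Or.inr rfl⟩
      · exact iff_of_false (hntri i j) fun h => h.2.elim (Fin.succ_ne_zero i) (Fin.succ_ne_zero j)⟩
  have hψ : ∀ i, (ψ i : V) = starEmb ρ' i := fun i => rfl
  refine ⟨ψ.symm, ?_, fun u => ?_⟩
  · rw [RelIso.symm_apply_eq]
    exact Subtype.ext rfl
  · obtain ⟨i, rfl⟩ := ψ.surjective u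
    rw [RelIso.symm_apply_apply, hψ]
    refine Fin.cases ?_ (fun i => ?_) i
    · exact h0.symm
    · have := hπ (π.symm i)
      rw [Equiv.apply_symm_apply] at this
      exact this.symm

variable [Fintype V]

open Classical in
/-- The enumerations of all neighbourhoods of `G`. -/
def portings (d : ℕ) (G : SimpleGraph V) : Finset (V → Fin d → V) :=
  Fintype.piFinset fun v =>
    Finset.univ.filter fun a : Fin d → V => Function.Injective a ∧ ∀ i, a i ∈ G.neighborSet v

theorem mem_portings {G : SimpleGraph V} {P : V → Fin d → V} :
    P ∈ portings d G ↔ ∀ v, Function.Injective (P v) ∧ ∀ i, G.Adj v (P v i) := by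
  simp [portings]

theorem card_portings {G : SimpleGraph V} (hG : G ∈ regFinset d V) :
    (portings d G).card = d.factorial ^ Fintype.card V := by
  classical
  rw [portings, Fintype.card_piFinset]
  rw [Finset.prod_congr rfl fun v _ => ?_, Finset.prod_const, Finset.card_univ]
  convert card_injective_mem (mem_regFinset.1 hG v)

theorem exists_apply_eq_of_mem_portings {G : SimpleGraph V} (hG : G ∈ regFinset d V)
    {P : V → Fin d → V} (hP : P ∈ portings d G) (v w : V) : G.Adj v w ↔ ∃ i, P v i = w := by
  rw [mem_portings] at hP
  have h : Set.range (P v) = G.neighborSet v := by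
    refine Set.eq_of_subset_of_ncard_le ?_ ?_ (Set.toFinite _)
    · rintro _ ⟨i, rfl⟩
      exact (hP v).2 i
    · rw [mem_regFinset.1 hG v, ← Set.image_univ, Set.ncard_image_of_injective _ (hP v).1,
        Set.ncard_univ, Nat.card_eq_fintype_card, Fintype.card_fin]
  rw [← SimpleGraph.mem_neighborSet, ← h]
  rfl

variable [DecidableEq V] [DecidableEq S]

/-- The half-edge `(v, i)` leads to `w = P v i` and is matched with `(w, j)`, where `v` is the
`j`-th neighbour of `w`. The two ends see the same pair of labels in opposite order. -/
theorem exists_matching_of_mem_portings {G : SimpleGraph V} (hG : G ∈ regFinset d V)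
    {P : V → Fin d → V} (hP : P ∈ portings d G) (f : V → S) :
    ∃ ι ∈ typedMatchings (halfEdgeType (starLabel f P)) Prod.swap Finset.univ,
      ∀ x : V × Fin d, (ι x).1 = P x.1 x.2 := by
  have hadj := exists_apply_eq_of_mem_portings hG hP
  have hP' := mem_portings.1 hP
  have hj : ∀ x : V × Fin d, ∃ j, P (P x.1 x.2) j = x.1 := fun x =>
    (hadj _ _).1 ((hP' x.1).2 x.2).symm
  choose j hj using hj
  let g : V × Fin d → V × Fin d := fun x => (P x.1 x.2, j x)
  have hg : Function.Involutive g := by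
    intro x
    refine Prod.ext (hj x) ((hP' x.1).1 ?_)
    have := hj (g x)
    simp only [g, hj x] at this
    exact this
  refine ⟨hg.toPerm, mem_typedMatchings.2 ⟨fun x => hg x, fun x => ?_, fun x _ => ?_⟩, fun x => rfl⟩
  · refine iff_of_true (fun h => ?_) (Finset.mem_univ x)
    exact ((hP' x.1).2 x.2).ne (congrArg Prod.fst h).symm
  · change (f (P x.1 x.2), f (P (P x.1 x.2) (j x))) = (f (P x.1 x.2), f x.1)
    rw [hj x]

/-- A coloured regular graph with enumerated neighbourhoods is determined by the labels of the
stars and a matching of the half-edges that respects the labels. -/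
theorem card_mul_le_sum_typedMatchings {A : Finset (SimpleGraph V)} (hA : A ⊆ regFinset d V)
    (f : SimpleGraph V → V → S) (Λ : Finset (V → Fin (d + 1) → S))
    (hf : ∀ G ∈ A, ∀ P ∈ portings d G, starLabel (f G) P ∈ Λ) :
    A.card * d.factorial ^ Fintype.card V ≤
      ∑ σ ∈ Λ, (typedMatchings (halfEdgeType σ) Prod.swap Finset.univ).card := by
  have hex : ∀ q : Σ _ : SimpleGraph V, V → Fin d → V, ∃ ι : Equiv.Perm (V × Fin d),
      q ∈ A.sigma (portings d) →
        ι ∈ typedMatchings (halfEdgeType (starLabel (f q.1) q.2)) Prod.swap Finset.univ ∧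
          ∀ x : V × Fin d, (ι x).1 = q.2 x.1 x.2 := by
    intro q
    by_cases hq : q ∈ A.sigma (portings d)
    · rw [Finset.mem_sigma] at hq
      obtain ⟨ι, h1, h2⟩ := exists_matching_of_mem_portings (hA hq.1) hq.2 (f q.1)
      exact ⟨ι, fun _ => ⟨h1, h2⟩⟩
    · exact ⟨1, fun h => absurd h hq⟩
  choose ι hι using hex
  calc _ = ∑ G ∈ A, (portings d G).card := by
        rw [Finset.sum_congr rfl fun G hG => card_portings (hA hG)]
        simp
    _ = (A.sigma (portings d)).card := (Finset.card_sigma _ _).symm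
    _ ≤ (Λ.sigma fun σ => typedMatchings (halfEdgeType σ) Prod.swap Finset.univ).card := by
        refine Finset.card_le_card_of_injOn (fun q => ⟨starLabel (f q.1) q.2, ι q⟩) ?_ ?_
        · intro q hq
          have hq' := Finset.mem_sigma.1 hq
          exact Finset.mem_sigma.2 ⟨hf _ hq'.1 _ hq'.2, (hι q hq).1⟩
        · intro q hq q' hq' h
          have h1 := (Sigma.mk.inj_iff.1 h).2
          rw [heq_eq_eq] at h1
          have hP : q.2 = q'.2 := by
            funext v i
            rw [← (hι q hq).2 (v, i), ← (hι q' hq').2 (v, i), h1]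
          obtain ⟨G, P⟩ := q
          obtain ⟨G', P'⟩ := q'
          obtain rfl : P = P' := hP
          have hq := Finset.mem_sigma.1 hq
          have hq' := Finset.mem_sigma.1 hq'
          have hGG : G = G' := by
            ext v w
            rw [exists_apply_eq_of_mem_portings (hA hq.1) hq.2,
              exists_apply_eq_of_mem_portings (hA hq'.1) hq'.2]
          rw [hGG]
    _ = _ := Finset.card_sigma _ _

end Ports

/-! ### Entropy estimates -/

section Typical

variable {V S : Type*} [Fintype V] [Fintype S] {d : ℕ}

open Classical in
/-- The labellings of the star that agree with `c` up to a permutation of the leaves. -/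
def starClass (c : Fin (d + 1) → S) : Finset (Fin (d + 1) → S) :=
  Finset.univ.filter (SameStar c)

theorem mem_starClass {c c' : Fin (d + 1) → S} : c' ∈ starClass c ↔ SameStar c c' := by
  simp [starClass]

theorem card_starClass_pos (c : Fin (d + 1) → S) : 0 < (starClass c).card :=
  Finset.card_pos.2 ⟨c, mem_starClass.2 (SameStar.refl c)⟩

theorem starClass_eq {c c' : Fin (d + 1) → S} (h : SameStar c c') :
    starClass c = starClass c' := by
  ext x
  simp only [mem_starClass]
  exact ⟨h.symm.trans, h.trans⟩

open Classical in
/-- The statistics of the star labels `σ` are at least those of `p`, up to `ε`. -/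
def IsNearlyTypical (p : (Fin (d + 1) → S) → ℝ) (ε : ℝ) (σ : V → Fin (d + 1) → S) : Prop :=
  ∀ c, Fintype.card V * ((starClass c).card * p c - ε) ≤
    (Finset.univ.filter fun v => SameStar c (σ v)).card

/-- Lower bounds on the frequencies suffice for an upper bound on averages: they are applied to the
nonnegative function `B - g`, and `p` has total mass one. -/
theorem IsNearlyTypical.sum_le {p : (Fin (d + 1) → S) → ℝ} {ε : ℝ} {σ : V → Fin (d + 1) → S}
    (h : IsNearlyTypical p ε σ) (hp : ∑ c, p c = 1) (hε : 0 ≤ ε)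
    {g : (Fin (d + 1) → S) → ℝ} (hg : ∀ c c', SameStar c c' → g c' = g c) {B : ℝ}
    (hB : ∀ c, g c ≤ B) :
    ∑ v, g (σ v) ≤ Fintype.card V * (∑ c, p c * g c + ε * ∑ c, (B - g c)) := by
  classical
  -- The sum over `c` meets each class once per representative; dividing by the size of the class
  -- corrects for this.
  have h1 : ∀ v, B - g (σ v) =
      ∑ c, if SameStar c (σ v) then (B - g c) / (starClass c).card else 0 := by
    intro v
    rw [← Finset.sum_filter]
    have : ∀ c ∈ Finset.univ.filter fun c => SameStar c (σ v),
        (B - g c) / (starClass c).card = (B - g (σ v)) / (starClass (σ v)).card := by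
      intro c hc
      have hc' := (Finset.mem_filter.1 hc).2
      rw [starClass_eq hc', hg c _ hc']
    rw [Finset.sum_congr rfl this, Finset.sum_const]
    have h2 : (Finset.univ.filter fun c => SameStar c (σ v)) = starClass (σ v) := by
      ext c
      simp only [Finset.mem_filter, Finset.mem_univ, true_and, mem_starClass]
      exact ⟨SameStar.symm, SameStar.symm⟩
    have h3 : ((starClass (σ v)).card : ℝ) ≠ 0 := by exact_mod_cast (card_starClass_pos _).ne'
    rw [h2, nsmul_eq_mul]
    field_simp
  have h2 : ∑ v, (B - g (σ v)) = ∑ c, (B - g c) / (starClass c).card *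
      (Finset.univ.filter fun v => SameStar c (σ v)).card := by
    rw [Finset.sum_congr rfl fun v _ => h1 v, Finset.sum_comm]
    refine Finset.sum_congr rfl fun c _ => ?_
    rw [← Finset.sum_filter, Finset.sum_const, nsmul_eq_mul, mul_comm]
  have h3 : ∀ c, Fintype.card V * ((B - g c) * (p c - ε)) ≤ (B - g c) / (starClass c).card *
      (Finset.univ.filter fun v => SameStar c (σ v)).card := by
    intro c
    have hpos : (1 : ℝ) ≤ (starClass c).card := by exact_mod_cast card_starClass_pos c
    have hBc : 0 ≤ B - g c := sub_nonneg.2 (hB c)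
    refine le_trans ?_ (mul_le_mul_of_nonneg_left (h c) (by positivity))
    have h4 : (B - g c) / (starClass c).card *
        (Fintype.card V * ((starClass c).card * p c - ε)) =
        Fintype.card V * ((B - g c) * (p c - ε / (starClass c).card)) := by
      field_simp
    rw [h4]
    gcongr
    exact div_le_self hε hpos
  have h4 := Finset.sum_le_sum fun c (_ : c ∈ Finset.univ) => h3 c
  rw [← h2, ← Finset.mul_sum, Finset.sum_sub_distrib, Finset.sum_const, Finset.card_univ,
    nsmul_eq_mul] at h4
  have h5 : ∑ c, (B - g c) * (p c - ε) = B - ∑ c, p c * g c - ε * ∑ c, (B - g c) := by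
    calc _ = ∑ c, (B * p c - p c * g c - ε * (B - g c)) :=
          Finset.sum_congr rfl fun c _ => by ring
      _ = _ := by
          rw [Finset.sum_sub_distrib, Finset.sum_sub_distrib, ← Finset.mul_sum, ← Finset.mul_sum,
            hp, mul_one]
  rw [h5] at h4
  nlinarith

/-- Averages of symmetric functions over nearly typical star labels. -/
theorem eventually_sum_le_of_isNearlyTypical {p : (Fin (d + 1) → S) → ℝ} (hp : ∑ c, p c = 1)
    {g : (Fin (d + 1) → S) → ℝ} (hg : ∀ c c', SameStar c c' → g c' = g c) {δ : ℝ} (hδ : 0 < δ) :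
    ∀ᶠ ε in 𝓝[>] (0 : ℝ), ∀ (n : ℕ) (σ : Fin n → Fin (d + 1) → S),
      IsNearlyTypical p ε σ → ∑ v, g (σ v) ≤ n * (∑ c, p c * g c + δ) := by
  obtain ⟨B, hB⟩ := (Set.finite_range g).bddAbove
  have hB' : ∀ c, g c ≤ B := fun c => hB ⟨c, rfl⟩
  set K := ∑ c, (B - g c) with hK
  have hK0 : 0 ≤ K := Finset.sum_nonneg fun c _ => sub_nonneg.2 (hB' c)
  filter_upwards [Ioc_mem_nhdsGT (show 0 < δ / (K + 1) by positivity)] with ε hε' n σ hσ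
  obtain ⟨h0, hε⟩ := hε'
  refine (hσ.sum_le hp h0.le hg hB').trans ?_
  rw [Fintype.card_fin, ← hK]
  have h1 : ε * K ≤ δ := by
    rw [le_div_iff₀ (by positivity)] at hε
    nlinarith
  gcongr

end Typical

/-! ### Cross entropy and factorial estimates -/

section Counting

/-- Sequences of small cross entropy are few. -/
theorem card_le_exp_of_cross_entropy {V A : Type*} [Fintype V] [Fintype A] {p : A → ℝ}
    (hp : ∀ a, 0 < p a) (hp1 : ∑ a, p a = 1) {F : Finset (V → A)} {E : ℝ}
    (hF : ∀ σ ∈ F, ∑ v, -Real.log (p (σ v)) ≤ E) : (F.card : ℝ) ≤ Real.exp E := by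
  classical
  have h1 : ∀ σ ∈ F, Real.exp (-E) ≤ ∏ v, p (σ v) := by
    intro σ hσ
    rw [← Real.exp_log (Finset.prod_pos fun v _ => hp (σ v)),
      Real.log_prod (fun v _ => (hp (σ v)).ne')]
    refine Real.exp_le_exp.2 ?_
    have := hF σ hσ
    rw [Finset.sum_neg_distrib] at this
    linarith
  have h2 : (F.card : ℝ) * Real.exp (-E) ≤ 1 := by
    calc _ ≤ ∑ σ ∈ F, ∏ v, p (σ v) := by
          rw [← nsmul_eq_mul]
          exact Finset.card_nsmul_le_sum _ _ _ h1
      _ ≤ ∑ σ : V → A, ∏ v, p (σ v) := by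
          refine Finset.sum_le_sum_of_subset_of_nonneg (Finset.subset_univ _) fun σ _ _ => ?_
          exact Finset.prod_nonneg fun v _ => (hp _).le
      _ = ∏ _v : V, ∑ a, p a := by
          rw [Finset.prod_univ_sum, Fintype.piFinset_univ]
      _ = 1 := by simp [hp1]
  rwa [Real.exp_neg, ← div_eq_mul_inv, div_le_one (Real.exp_pos _)] at h2

/-- Mixing a probability vector with a little of the uniform one. -/
theorem exists_pos_cross_entropy_le {A : Type*} [Fintype A] [Nonempty A] {p : A → ℝ}
    (hp : ∀ a, 0 ≤ p a) (hp1 : ∑ a, p a = 1) {δ : ℝ} (hδ : 0 < δ) :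
    ∃ p' : A → ℝ, (∀ a, 0 < p' a) ∧ ∑ a, p' a = 1 ∧ (∀ a b, p a = p b → p' a = p' b) ∧
      ∑ a, p a * -Real.log (p' a) ≤ ∑ a, Real.negMulLog (p a) + δ := by
  have he : 0 < 1 - Real.exp (-δ) := by
    have : Real.exp (-δ) < 1 := by simpa using hδ
    linarith
  have hA : (0 : ℝ) < Fintype.card A := by exact_mod_cast Fintype.card_pos
  -- The weight `exp (-δ)` on `p` raises `-log` by at most `δ` wherever `p` is positive.
  refine ⟨fun a => Real.exp (-δ) * p a + (1 - Real.exp (-δ)) / Fintype.card A, fun a => ?_, ?_,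
    fun a b h => by simp only [h], ?_⟩
  · have := hp a
    positivity
  · rw [Finset.sum_add_distrib, ← Finset.mul_sum, hp1, Finset.sum_const, Finset.card_univ,
      nsmul_eq_mul]
    field_simp
    ring
  · have key : ∀ a, p a * -Real.log (Real.exp (-δ) * p a + (1 - Real.exp (-δ)) / Fintype.card A) ≤
        Real.negMulLog (p a) + p a * δ := by
      intro a
      rcases (hp a).eq_or_lt with h | h
      · simp [← h]
      · have h1 : Real.log (Real.exp (-δ) * p a) ≤
            Real.log (Real.exp (-δ) * p a + (1 - Real.exp (-δ)) / Fintype.card A) :=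
          Real.log_le_log (by positivity) (by
            have : 0 < (1 - Real.exp (-δ)) / Fintype.card A := by positivity
            linarith)
        rw [Real.log_mul (Real.exp_pos _).ne' h.ne', Real.log_exp] at h1
        rw [Real.negMulLog]
        nlinarith
    refine (Finset.sum_le_sum fun a _ => key a).trans (le_of_eq ?_)
    rw [Finset.sum_add_distrib, ← Finset.sum_mul, hp1, one_mul]

theorem log_factorial_le (N : ℕ) :
    Real.log N.factorial ≤ N * Real.log N - N + Real.log (N + 1) + 1 := by
  have key : ∀ N : ℕ, Real.log N.factorial ≤ (N + 1) * Real.log (N + 1) - N := by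
    intro N
    induction N with
    | zero => simp
    | succ N ih =>
      have h1 : (0 : ℝ) < N + 1 := by positivity
      have h2 : (0 : ℝ) < N + 1 + 1 := by positivity
      rw [Nat.factorial_succ, Nat.cast_mul, Real.log_mul (by positivity) (by positivity)]
      push_cast
      have h3 := Real.log_le_sub_one_of_pos (div_pos h1 h2)
      rw [Real.log_div h1.ne' h2.ne'] at h3
      have h4 : (N + 1 + 1 : ℝ) * ((N + 1) / (N + 1 + 1) - 1) = -1 := by
        field_simp
        ring
      have h5 := mul_le_mul_of_nonneg_left h3 h2.le
      rw [h4] at h5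
      linarith
  refine (key N).trans ?_
  rcases Nat.eq_zero_or_pos N with rfl | hN
  · simp
  · have h1 : (0 : ℝ) < N := by exact_mod_cast hN
    have h2 := Real.log_le_sub_one_of_pos (div_pos (by positivity : (0 : ℝ) < N + 1) h1)
    rw [Real.log_div (by positivity) h1.ne'] at h2
    have h3 : (N : ℝ) * ((N + 1) / N - 1) = 1 := by
      field_simp
      ring
    have h4 := mul_le_mul_of_nonneg_left h2 h1.le
    rw [h3] at h4
    linarith

/-- A product of factorials in terms of the entropy of the proportions. -/
theorem sum_log_factorial_le {K : Type*} [Fintype K] (N : K → ℕ) {M : ℕ} (hM : 0 < M)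
    (hN : ∑ k, N k = M) :
    ∑ k, Real.log (N k).factorial ≤ M * Real.log M - M -
      M * ∑ k, Real.negMulLog (N k / M) + Fintype.card K * (Real.log (M + 1) + 1) := by
  have hM' : (0 : ℝ) < M := by exact_mod_cast hM
  have hN' : ∑ k, (N k : ℝ) = M := by exact_mod_cast hN
  have key : ∀ k, Real.log (N k).factorial ≤ N k * Real.log M - N k -
      M * Real.negMulLog (N k / M) + (Real.log (M + 1) + 1) := by
    intro k
    refine (log_factorial_le (N k)).trans ?_
    have h1 : (N k : ℝ) ≤ M := by
      rw [← hN]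
      exact_mod_cast Finset.single_le_sum (fun _ _ => Nat.zero_le _) (Finset.mem_univ k)
    have h2 : Real.log (N k + 1) ≤ Real.log (M + 1) := Real.log_le_log (by positivity) (by linarith)
    have h3 : (N k : ℝ) * Real.log (N k) =
        N k * Real.log M - M * Real.negMulLog (N k / M) := by
      rcases Nat.eq_zero_or_pos (N k) with h0 | h0
      · simp [h0]
      · have h0' : (0 : ℝ) < N k := by exact_mod_cast h0
        rw [Real.negMulLog, Real.log_div h0'.ne' hM'.ne']
        field_simp
        ring
    linarith
  refine (Finset.sum_le_sum fun k _ => key k).trans (le_of_eq ?_)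
  rw [Finset.sum_add_distrib, Finset.sum_sub_distrib, Finset.sum_sub_distrib, ← Finset.sum_mul,
    ← Finset.mul_sum, hN']
  simp [mul_add]

end Counting

/-! ### Typical processes have many nearly typical regular graphs -/

section Probability

variable {V S : Type*} {d : ℕ}

/-- Otherwise a component would be a finite tree with all degrees at least two, hence without a
leaf. -/
theorem exists_isCycle_length_le {n : ℕ} {G : SimpleGraph (Fin n)} (hd : 2 ≤ d)
    (hG : G ∈ regFinset d (Fin n)) (hn : 0 < n) :
    ∃ (v : Fin n) (p : G.Walk v v), p.IsCycle ∧ p.length ≤ n := by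
  classical
  have hcyc : ¬ G.IsAcyclic := by
    intro h
    let C := G.connectedComponentMk ⟨0, hn⟩
    have hdeg : ∀ v : C, (C.toSimpleGraph.neighborSet v).ncard = d := by
      intro v
      rw [← mem_regFinset.1 hG v, ← Set.ncard_image_of_injective _ Subtype.val_injective]
      congr 1
      ext w
      simp only [Set.mem_image, SimpleGraph.mem_neighborSet]
      constructor
      · rintro ⟨w, hw, rfl⟩
        exact (C.toSimpleGraph_adj v.2 w.2).1 hw
      · intro hw
        have hwC : w ∈ C :=
          (SimpleGraph.ConnectedComponent.mem_supp_congr_adj C hw).1 v.2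
        exact ⟨⟨w, hwC⟩, (C.toSimpleGraph_adj v.2 hwC).2 hw, rfl⟩
    have htree := h.isTree_connectedComponent C
    have hdeg' : ∀ v : C, C.toSimpleGraph.degree v = d := fun v =>
      (by convert degree_eq_ncard C.toSimpleGraph v : C.toSimpleGraph.degree v = _).trans (hdeg v)
    have hnt : Nontrivial C := by
      let v₀ : C := ⟨⟨0, hn⟩, rfl⟩
      obtain ⟨w, hw⟩ := (C.toSimpleGraph.degree_pos_iff_exists_adj v₀).1 (by rw [hdeg']; omega)
      exact ⟨v₀, w, hw.ne⟩
    obtain ⟨v, hv⟩ := htree.exists_vert_degree_one_of_nontrivial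
    rw [hdeg' v] at hv
    omega
  simp only [SimpleGraph.IsAcyclic, not_forall, not_not] at hcyc
  obtain ⟨v, p, hp⟩ := hcyc
  refine ⟨v, p, hp, ?_⟩
  have h := hp.support_nodup.length_le_card
  rw [Fintype.card_fin, List.length_tail, SimpleGraph.Walk.length_support] at h
  exact h

/-- Typicality does not ask that `n i` tend to infinity; large girth forces it on nonempty graphs.
If `0 < n i < N`, one vertex on a cycle of length at most `n i` has frequency `1 / n i > 1 / (N +
1)`, contradicting large girth at `1 / (N + 1)`. -/
theorem IsLargeGirth.eventually_ge {n : ℕ → ℕ} {G : ∀ i, SimpleGraph (Fin (n i))}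
    (hG : IsLargeGirth G) (hd : 2 ≤ d) (hreg : ∀ i, G i ∈ regFinset d (Fin (n i))) (N : ℕ) :
    ∀ᶠ i in atTop, 0 < n i → N ≤ n i := by
  obtain ⟨I, hI⟩ := hG (1 / (N + 1 : ℝ)) (by positivity)
  filter_upwards [eventually_ge_atTop I] with i hi hpos
  by_contra hlt
  obtain ⟨v, p, hp, hlen⟩ := exists_isCycle_length_le hd (hreg i) hpos
  have h := hI i hi
  have hceil : ⌈1 / (1 / (N + 1 : ℝ))⌉₊ = N + 1 := by
    rw [one_div_one_div]
    exact_mod_cast Nat.ceil_natCast (N + 1)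
  rw [hceil] at h
  have h1 : 1 ≤ {v : Fin (n i) | ∃ p : (G i).Walk v v, p.IsCycle ∧ p.length ≤ N + 1}.ncard :=
    (Set.ncard_pos (Set.toFinite _)).2 ⟨v, p, hp, by omega⟩
  have h2 : (1 : ℝ) / n i ≤ 1 / (N + 1 : ℝ) :=
    le_trans (by gcongr; exact_mod_cast h1) h
  have h3 : (n i : ℝ) < N + 1 := by
    have : (n i : ℝ) < N := by exact_mod_cast not_le.1 hlt
    linarith
  have h4 := one_div_lt_one_div_of_lt (by exact_mod_cast hpos) h3
  linarith

open Classical in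
/-- Events that almost surely hold eventually for independent random regular graphs eventually hold
for at least half of the regular graphs. -/
theorem eventually_card_le {n : ℕ → ℕ} (hn : ∀ i, (regularGraphs d (n i)).Nonempty)
    {E : ∀ i, Set (SimpleGraph (Fin (n i)))}
    (hE : ∀ᵐ G ∂(randomRegularGraphs d n), ∀ᶠ i in atTop, G i ∈ E i) :
    ∀ᶠ i in atTop, (regFinset d (Fin (n i))).card ≤
      2 * ((regFinset d (Fin (n i))).filter fun G => G ∈ E i).card := by
  have hprob : ∀ i, IsProbabilityMeasure (uniformOn (regularGraphs d (n i))) := fun i =>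
    isProbabilityMeasure_uniformOn (Set.toFinite _) (hn i)
  have hprob' : IsProbabilityMeasure (randomRegularGraphs d n) := by
    unfold randomRegularGraphs
    infer_instance
  -- The events that some failure occurs from index `k` on decrease to a null set, so their
  -- probabilities tend to zero.
  let B : ℕ → Set (∀ i, SimpleGraph (Fin (n i))) := fun k => ⋃ i ≥ k, (fun G => G i) ⁻¹' (E i)ᶜ
  have hBm : ∀ k, MeasurableSet (B k) := fun k =>
    MeasurableSet.iUnion fun i => MeasurableSet.iUnion fun _ =>
      measurable_pi_apply i (Set.toFinite _).measurableSet
  have hBa : Antitone B := fun k l hkl =>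
    Set.iUnion_mono fun i => Set.iUnion_subset fun hi => Set.subset_iUnion_of_subset
      (le_trans hkl hi) subset_rfl
  have hB0 : randomRegularGraphs d n (⋂ k, B k) = 0 := by
    refine measure_mono_null (fun G hG => ?_) (ae_iff.1 hE)
    simp only [Set.mem_ofPred_eq, eventually_atTop, not_exists, not_forall]
    intro k
    have := Set.mem_iInter.1 hG k
    simpa [B] using this
  have hlim := tendsto_measure_iInter_atTop (μ := randomRegularGraphs d n)
    (fun k => (hBm k).nullMeasurableSet) hBa ⟨0, measure_ne_top _ _⟩
  rw [hB0] at hlim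
  have hhalf : (0 : ENNReal) < 1 / 2 := by norm_num
  filter_upwards [hlim.eventually (gt_mem_nhds hhalf)] with i hi
  have h1 : randomRegularGraphs d n ((fun G => G i) ⁻¹' (E i)ᶜ) < 1 / 2 :=
    lt_of_le_of_lt (measure_mono (Set.subset_iUnion₂_of_subset i le_rfl subset_rfl)) hi
  have hmap : randomRegularGraphs d n ((fun G => G i) ⁻¹' (E i)ᶜ) =
      uniformOn (regularGraphs d (n i)) (E i)ᶜ :=
    (measurePreserving_eval_infinitePi (fun i => uniformOn (regularGraphs d (n i))) i
      ).measure_preimage (Set.toFinite _).measurableSet.nullMeasurableSet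
  rw [hmap, ← coe_regFinset, ← uniformOn_inter_self (Finset.finite_toSet _)] at h1
  have h2 : ((regFinset d (Fin (n i)) : Set (SimpleGraph (Fin (n i)))) ∩ (E i)ᶜ) =
      ((regFinset d (Fin (n i))).filter fun G => G ∉ E i : Finset _) := by
    ext G
    simp
  rw [h2, uniformOn_apply_finset] at h1
  have hpos : 0 < (regFinset d (Fin (n i))).card := by
    rw [Finset.card_pos, ← Finset.coe_nonempty, coe_regFinset]
    exact hn i
  rw [Finset.inter_eq_right.2 (Finset.filter_subset _ _),
    ENNReal.div_lt_iff (Or.inl (by exact_mod_cast hpos.ne')) (Or.inl (ENNReal.natCast_ne_top _))]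
    at h1
  have h3 : 2 * ((regFinset d (Fin (n i))).filter fun G => G ∉ E i).card <
      (regFinset d (Fin (n i))).card := by
    have h4 := ENNReal.mul_lt_mul_right (a := 2) (by norm_num) (by norm_num) h1
    rw [← mul_assoc, one_div, ENNReal.mul_inv_cancel (by norm_num) (by norm_num), one_mul] at h4
    exact_mod_cast h4
  have h5 := Finset.card_filter_add_card_filter_not (s := regFinset d (Fin (n i)))
    (fun G => G ∈ E i)
  omega

theorem ae_forall_mem_regFinset {n : ℕ → ℕ} (hn : ∀ i, (regularGraphs d (n i)).Nonempty) :
    ∀ᵐ G ∂(randomRegularGraphs d n), ∀ i, G i ∈ regFinset d (Fin (n i)) := by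
  have hprob : ∀ i, IsProbabilityMeasure (uniformOn (regularGraphs d (n i))) := fun i =>
    isProbabilityMeasure_uniformOn (Set.toFinite _) (hn i)
  rw [ae_all_iff]
  intro i
  have h : ∀ᵐ G ∂(uniformOn (regularGraphs d (n i))), G ∈ regFinset d (Fin (n i)) := by
    rw [← coe_regFinset, ae_iff, uniformOn_eq_zero_iff (Finset.finite_toSet _)]
    ext G
    simp
  exact (measurePreserving_eval_infinitePi
    (fun i => uniformOn (regularGraphs d (n i))) i).quasiMeasurePreserving.ae h

variable {T : SimpleGraph V} [T.LocallyFinite] [Fintype S] [MeasurableSpace S]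
  [MeasurableSingletonClass S] {ν : Measure (V → S)}

/-- The labellings in a class are equally likely, and each gives the same rooted coloured
neighbourhood. Near typicality uses only this direction. -/
theorem IsInvariantProcess.card_mul_patternProb_le (hν : IsInvariantProcess T ν)
    (hT : IsRegularTree d T) {o : V} (ρ : Fin d ≃ T.neighborSet o) (c : Fin (d + 1) → S) :
    (starClass c).card * patternProb ν (starEmb ρ) c ≤
      ν.real {ω | NbhdIso T ω o 1 (starGraph d) c 0} := by
  classical
  have := hν.isProbabilityMeasure
  have h := measureReal_comp_eq_sum ν (starEmb ρ) (SameStar c)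
  have h2 : ∑ c' with SameStar c c', patternProb ν (starEmb ρ) c' =
      (starClass c).card * patternProb ν (starEmb ρ) c := by
    rw [Finset.sum_congr rfl fun c' hc' =>
      hν.patternProb_eq_of_sameStar hT ρ (Finset.mem_filter.1 hc').2, Finset.sum_const,
      nsmul_eq_mul]
    congr 3
  rw [← h2, ← h]
  exact measureReal_mono fun ω hω => nbhdIso_of_sameStar hT.isTree.isAcyclic ρ hω

/-- If `ν` is typical, then at least half of the regular graphs on some large number of vertices
carry a colouring whose star statistics are close to those of `ν`. -/
theorem IsTypical.exists_nearlyTypical {o : V} (hν : IsTypical d T o ν) (hT : IsRegularTree d T)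
    (hd : 2 ≤ d) (ρ : Fin d ≃ T.neighborSet o) {ε : ℝ} (hε : 0 < ε) (N : ℕ) :
    ∃ n ≥ N, ∃ A ⊆ regFinset d (Fin n), ∃ f : SimpleGraph (Fin n) → Fin n → S,
      0 < (regFinset d (Fin n)).card ∧ (regFinset d (Fin n)).card ≤ 2 * A.card ∧
        ∀ G ∈ A, ∀ P ∈ portings d G,
          IsNearlyTypical (patternProb ν (starEmb ρ)) ε (starLabel (f G) P) := by
  classical
  obtain ⟨hinv, n, hn, hae⟩ := hν
  have := hinv.isProbabilityMeasure
  set p := patternProb ν (starEmb ρ) with hp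
  let E : ∀ i, Set (SimpleGraph (Fin (n i))) := fun i => {G | N ≤ n i ∧ ∃ f : Fin (n i) → S,
    ∀ c, n i * ((starClass c).card * p c - ε) ≤
      {v : Fin (n i) | NbhdIso G f v 1 (starGraph d) c 0}.ncard}
  have hE : ∀ᵐ G ∂(randomRegularGraphs d n), ∀ᶠ i in atTop, G i ∈ E i := by
    filter_upwards [hae, ae_forall_mem_regFinset hn] with G hG hreg
    obtain ⟨hgirth, -, f, hf⟩ := hG
    -- A pattern of positive probability excludes `n i = 0` for large `i`, since frequencies in the
    -- empty graph are `0 / 0 = 0`.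
    obtain ⟨c₀, hc₀⟩ : ∃ c, 0 < p c := by
      by_contra hcon
      push Not at hcon
      have h1 := sum_patternProb ν (starEmb ρ)
      have h2 : ∑ c, patternProb ν (starEmb ρ) c ≤ 0 := Finset.sum_nonpos fun c _ => hcon c
      linarith
    have hlim₀ := hf 1 (d + 1) (starGraph d) c₀ 0
    have hpos₀ : 0 < ν.real {ω | NbhdIso T ω o 1 (starGraph d) c₀ 0} := by
      refine lt_of_lt_of_le ?_ (hinv.card_mul_patternProb_le hT ρ c₀)
      have : (0 : ℝ) < (starClass c₀).card := by exact_mod_cast card_starClass_pos c₀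
      positivity
    have hpos : ∀ᶠ i in atTop, 0 < n i := by
      filter_upwards [hlim₀.eventually (lt_mem_nhds hpos₀)] with i hi
      rcases Nat.eq_zero_or_pos (n i) with h | h
      · have h0 : (n i : ℝ) = 0 := by exact_mod_cast h
        rw [h0, div_zero] at hi
        exact absurd hi (lt_irrefl 0)
      · exact h
    have hclose : ∀ᶠ i in atTop, ∀ c : Fin (d + 1) → S, (starClass c).card * p c - ε <
        ({v : Fin (n i) | NbhdIso (G i) (f i) v 1 (starGraph d) c 0}.ncard : ℝ) / n i := by
      rw [eventually_all]
      intro c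
      refine (hf 1 (d + 1) (starGraph d) c 0).eventually (lt_mem_nhds ?_)
      have := hinv.card_mul_patternProb_le hT ρ c
      linarith
    filter_upwards [hpos, hclose, hgirth.eventually_ge hd hreg N] with i h1 h2 h3
    refine ⟨h3 h1, f i, fun c => ?_⟩
    have h4 : (0 : ℝ) < n i := by exact_mod_cast h1
    have h5 := (lt_div_iff₀ h4).1 (h2 c)
    linarith
  obtain ⟨i, hi⟩ := (eventually_card_le hn hE).exists
  replace hi : (regFinset d (Fin (n i))).card ≤
      2 * ((regFinset d (Fin (n i))).filter fun G => G ∈ E i).card := by convert hi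
  have hpos : 0 < (regFinset d (Fin (n i))).card := by
    rw [Finset.card_pos, ← Finset.coe_nonempty, coe_regFinset]
    exact hn i
  have hne : ((regFinset d (Fin (n i))).filter fun G => G ∈ E i).Nonempty := by
    rw [← Finset.card_pos]
    omega
  obtain ⟨G₀, hG₀⟩ := hne
  have hG₀' : G₀ ∈ E i := (Finset.mem_filter.1 hG₀).2
  obtain ⟨f₀, -⟩ := hG₀'.2
  have hex : ∀ G : SimpleGraph (Fin (n i)), ∃ f : Fin (n i) → S, G ∈ E i →
      ∀ c, n i * ((starClass c).card * p c - ε) ≤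
        {v : Fin (n i) | NbhdIso G f v 1 (starGraph d) c 0}.ncard := by
    intro G
    by_cases hG : G ∈ E i
    · obtain ⟨f, hf⟩ := hG.2
      exact ⟨f, fun _ => hf⟩
    · exact ⟨f₀, fun h => absurd h hG⟩
  choose f hf using hex
  refine ⟨n i, hG₀'.1, (regFinset d (Fin (n i))).filter fun G => G ∈ E i,
    Finset.filter_subset _ _, f, hpos, hi, fun G hG P hP c => ?_⟩
  rw [Fintype.card_fin]
  refine (hf G (Finset.mem_filter.1 hG).2 c).trans ?_
  rw [Nat.cast_le, ← Set.ncard_coe_finset]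
  refine Set.ncard_le_ncard (fun v hv => ?_) (Set.toFinite _)
  have hPv := mem_portings.1 hP v
  have := sameStar_starLabel hv hPv.1 hPv.2
  simpa using this

end Probability

/-! ### The entropy inequality -/

section EntropyInequality

variable {V S : Type*} {d : ℕ}

section HalfEdges

variable [Fintype V] [DecidableEq S]

/-- The number of leaves labelled `k.2` if the centre is labelled `k.1`. -/
def leafCount (k : S × S) (c : Fin (d + 1) → S) : ℕ :=
  (Finset.univ.filter fun i : Fin d => c 0 = k.1 ∧ c i.succ = k.2).card

theorem leafCount_eq_of_sameStar (k : S × S) {c c' : Fin (d + 1) → S} (h : SameStar c c') :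
    leafCount k c' = leafCount k c := by
  obtain ⟨h0, π, hπ⟩ := h
  simp only [leafCount, Finset.card_filter, h0, hπ]
  exact Equiv.sum_comp π fun i => if c 0 = k.1 ∧ c i.succ = k.2 then 1 else 0

theorem typeCount_halfEdgeType (σ : V → Fin (d + 1) → S) (k : S × S) :
    typeCount (halfEdgeType σ) Finset.univ k = ∑ v, leafCount k (σ v) := by
  simp only [typeCount, leafCount, Finset.card_filter, Fintype.sum_prod_type, halfEdgeType,
    Prod.ext_iff]

theorem sum_typeCount_halfEdgeType [Fintype S] (σ : V → Fin (d + 1) → S) :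
    ∑ k, typeCount (halfEdgeType σ) Finset.univ k = d * Fintype.card V := by
  unfold typeCount
  rw [← Finset.card_eq_sum_card_fiberwise fun x _ => Finset.mem_coe.2 (Finset.mem_univ _)]
  simp [mul_comm]

theorem card_typedMatchings_halfEdgeType_le [DecidableEq V] [Fintype S]
    (σ : V → Fin (d + 1) → S) {M : ℕ} (hM : M = d * Fintype.card V) (hM0 : 0 < M) {h : ℝ}
    (hh : h ≤ ∑ k, Real.negMulLog (typeCount (halfEdgeType σ) Finset.univ k / M)) :
    ((typedMatchings (halfEdgeType σ) Prod.swap Finset.univ).card : ℝ) ≤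
      Real.exp ((M * Real.log M - M - M * h +
        Fintype.card (S × S) * (Real.log (M + 1) + 1)) / 2) := by
  have h1 := card_typedMatchings_sq_le (halfEdgeType σ) Prod.swap_swap Finset.univ
  have h2 := sum_log_factorial_le (typeCount (halfEdgeType σ) Finset.univ) hM0
    ((sum_typeCount_halfEdgeType σ).trans hM.symm)
  have h3 : (∏ k, (typeCount (halfEdgeType σ) Finset.univ k).factorial : ℝ) =
      Real.exp (∑ k, Real.log (typeCount (halfEdgeType σ) Finset.univ k).factorial) := by
    rw [Real.exp_sum]
    exact Finset.prod_congr rfl fun k _ =>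
      (Real.exp_log (by exact_mod_cast Nat.factorial_pos _)).symm
  refine (pow_le_pow_iff_left₀ (Nat.cast_nonneg _) (Real.exp_pos _).le two_ne_zero).1 ?_
  calc ((typedMatchings (halfEdgeType σ) Prod.swap Finset.univ).card : ℝ) ^ 2
      ≤ ∏ k, (typeCount (halfEdgeType σ) Finset.univ k).factorial := by exact_mod_cast h1
    _ = _ := by rw [Nat.cast_prod, h3]
    _ ≤ Real.exp (M * Real.log M - M - M * h +
        Fintype.card (S × S) * (Real.log (M + 1) + 1)) := by
        refine Real.exp_le_exp.2 (h2.trans ?_)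
        gcongr
    _ = _ := by
        rw [← Real.exp_nat_mul]
        congr 1
        push_cast
        ring

end HalfEdges

theorem eventually_log_le (d : ℕ) (K C : ℝ) (hK : 0 ≤ K) {δ : ℝ} (hδ : 0 < δ) :
    ∀ᶠ n : ℕ in atTop, K * (Real.log ((d * n : ℕ) + 1) + 1) / 2 + C ≤ δ * n := by
  have ht : Tendsto (fun n : ℕ => ((n + 1 : ℕ) : ℝ)) atTop atTop :=
    tendsto_natCast_atTop_atTop.comp (tendsto_add_atTop_nat 1)
  have hlim := ht.eventually (Real.isLittleO_log_id_atTop.def (show 0 < δ / (K + 1) by positivity))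
  have hconst := tendsto_natCast_atTop_atTop.eventually
    (eventually_ge_atTop ((K * (Real.log (d + 1) + 1) / 2 + C + δ / 2) / (δ / 2)))
  filter_upwards [hlim, hconst] with n h1 h2
  rw [div_le_iff₀ (by positivity)] at h2
  have h3 : Real.log ((d * n : ℕ) + 1) ≤ Real.log (d + 1) + Real.log ((n + 1 : ℕ) : ℝ) := by
    rw [← Real.log_mul (by positivity) (by positivity)]
    refine Real.log_le_log (by positivity) ?_
    push_cast
    nlinarith [(Nat.cast_nonneg d : (0 : ℝ) ≤ d), (Nat.cast_nonneg n : (0 : ℝ) ≤ n)]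
  have h4 : Real.log ((n + 1 : ℕ) : ℝ) ≤ δ / (K + 1) * (n + 1) := by
    refine (Real.le_norm_self _).trans (h1.trans (le_of_eq ?_))
    rw [id, Real.norm_of_nonneg (Nat.cast_nonneg _)]
    push_cast
    rfl
  have h5 : K * (δ / (K + 1)) ≤ δ := by
    rw [← mul_div_assoc, div_le_iff₀ (by positivity)]
    nlinarith
  have h6 : K * (δ / (K + 1) * (n + 1)) ≤ δ * (n + 1) := by
    rw [← mul_assoc]
    exact mul_le_mul_of_nonneg_right h5 (by positivity)
  have h7 := mul_le_mul_of_nonneg_left (h3.trans (add_le_add_right h4 _)) hK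
  rw [mul_add] at h7
  linarith

variable {T : SimpleGraph V} [T.LocallyFinite] [Fintype S] [MeasurableSpace S]
  [MeasurableSingletonClass S] {ν : Measure (V → S)}

/-- The comparison of the two counts, with all errors expressed through one `δ`. -/
theorem IsTypical.entropy_le {o : V} (hν : IsTypical d T o ν) (hT : IsRegularTree d T)
    (hd : 2 ≤ d) (ρ : Fin d ≃ T.neighborSet o) (j : Fin d) {δ : ℝ} (hδ : 0 < δ) :
    (d : ℝ) / 2 * ∑ k : S × S, Real.negMulLog (patternProb ν ![o, ρ j] ![k.1, k.2]) ≤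
      ∑ c, Real.negMulLog (patternProb ν (starEmb ρ) c) + (4 + d / 2) * δ := by
  classical
  have hinv := hν.1
  have := hinv.isProbabilityMeasure
  set p := patternProb ν (starEmb ρ) with hp
  set q : S × S → ℝ := fun k => patternProb ν ![o, ρ j] ![k.1, k.2] with hq
  have hp1 : ∑ c, p c = 1 := sum_patternProb ν (starEmb ρ)
  have hne : Nonempty (Fin (d + 1) → S) := by
    by_contra h
    rw [not_nonempty_iff] at h
    simp at hp1
  obtain ⟨p', hp'0, hp'1, hp'p, hp'H⟩ := exists_pos_cross_entropy_le
    (fun c => patternProb_nonneg ν (starEmb ρ) c) hp1 hδ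
  have hcont : Continuous fun r : S × S → ℝ => ∑ k, Real.negMulLog (r k) :=
    continuous_finsetSum _ fun k _ => Real.continuous_negMulLog.comp (continuous_apply k)
  -- Type frequencies within `η` of the edge marginal have entropy within `δ` of `h`.
  obtain ⟨η, hη, hηq⟩ := Metric.continuous_iff.1 hcont q δ hδ
  have hdpos : (1 : ℝ) ≤ d := by exact_mod_cast (by omega : 1 ≤ d)
  have hleaf : ∀ k : S × S, ∑ c, p c * (leafCount k c : ℝ) = d * q k := fun k =>
    hinv.sum_patternProb_mul_card hT ρ j k.1 k.2
  have hev1 := eventually_sum_le_of_isNearlyTypical hp1 (g := fun c => -Real.log (p' c))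
    (fun c c' h => by rw [hp'p _ _ (hinv.patternProb_eq_of_sameStar hT ρ h)]) hδ
  have hev2 := eventually_all.2 fun k : S × S => eventually_sum_le_of_isNearlyTypical hp1
    (g := fun c => (leafCount k c : ℝ)) (fun c c' h => by rw [leafCount_eq_of_sameStar k h])
    (half_pos hη)
  -- Averages are bounded only from above; the negated leaf counts supply the lower bounds.
  have hev3 := eventually_all.2 fun k : S × S => eventually_sum_le_of_isNearlyTypical hp1
    (g := fun c => -(leafCount k c : ℝ)) (fun c c' h => by rw [leafCount_eq_of_sameStar k h])
    (half_pos hη)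
  obtain ⟨ε, ⟨⟨h1, h2⟩, h3⟩, hε⟩ :=
    (((hev1.and hev2).and hev3).and self_mem_nhdsWithin).exists
  obtain ⟨N₁, C, hlow⟩ := exists_numPorted_lower_bound (by omega : 0 < d) hδ
  obtain ⟨N₂, hN₂⟩ := eventually_atTop.1
    (eventually_log_le d (Fintype.card (S × S)) (C + Real.log 2) (Nat.cast_nonneg _) hδ)
  obtain ⟨n, hn, A, hA, f, hpos, hcard, hf⟩ :=
    hν.exists_nearlyTypical hT hd ρ hε (N₁ + N₂ + 1)
  have hn0 : 0 < n := by omega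
  have hn0' : (0 : ℝ) < n := by exact_mod_cast hn0
  set M := d * n with hM
  have hM0 : 0 < M := Nat.mul_pos (by omega) hn0
  have hMn : (M : ℝ) = d * n := by rw [hM]; push_cast; rfl
  have hM0' : (0 : ℝ) < M := by exact_mod_cast hM0
  set h := ∑ k, Real.negMulLog (q k) with hh
  set H := ∑ c, Real.negMulLog (p c) with hH
  set Λ : Finset (Fin n → Fin (d + 1) → S) := Finset.univ.filter (IsNearlyTypical p ε) with hΛ
  have hΛcard : (Λ.card : ℝ) ≤ Real.exp (n * (H + 2 * δ)) := by
    refine card_le_exp_of_cross_entropy hp'0 hp'1 fun σ hσ => ?_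
    refine (h1 n σ (Finset.mem_filter.1 hσ).2).trans ?_
    have h4 : ∑ c, p c * -Real.log (p' c) ≤ H + δ := hp'H
    exact mul_le_mul_of_nonneg_left (by linarith) hn0'.le
  have hentropy : ∀ σ ∈ Λ,
      h - δ ≤ ∑ k, Real.negMulLog (typeCount (halfEdgeType σ) Finset.univ k / M) := by
    intro σ hσ
    have hσ' := (Finset.mem_filter.1 hσ).2
    have hdist : dist (fun k => (typeCount (halfEdgeType σ) Finset.univ k / M : ℝ)) q < η := by
      refine (dist_pi_lt_iff hη).2 fun k => ?_
      have e1 := h2 k n σ hσ'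
      have e2 := h3 k n σ hσ'
      simp only [Finset.sum_neg_distrib, mul_neg, hleaf] at e1 e2
      rw [typeCount_halfEdgeType, Nat.cast_sum, Real.dist_eq, abs_sub_lt_iff]
      have e3 : (n : ℝ) * (η / 2) < η * M := by
        rw [hMn]
        nlinarith [mul_pos hη hn0']
      constructor
      · rw [sub_lt_iff_lt_add, div_lt_iff₀ hM0', add_mul, hMn]
        rw [hMn] at e3
        linarith
      · rw [sub_lt_comm, lt_div_iff₀ hM0', sub_mul, hMn]
        rw [hMn] at e3
        linarith
    have := hηq _ hdist
    rw [Real.dist_eq, abs_lt] at this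
    linarith [this.1]
  have hcount := card_mul_le_sum_typedMatchings hA f Λ fun G hG P hP =>
    Finset.mem_filter.2 ⟨Finset.mem_univ _, hf G hG P hP⟩
  rw [Fintype.card_fin] at hcount
  set X := (M * Real.log M - M - M * (h - δ) +
    Fintype.card (S × S) * (Real.log (M + 1) + 1)) / 2 with hX
  have hcount' : (A.card * d.factorial ^ n : ℝ) ≤ Real.exp (n * (H + 2 * δ)) * Real.exp X := by
    calc (A.card * d.factorial ^ n : ℝ)
        ≤ ∑ σ ∈ Λ, ((typedMatchings (halfEdgeType σ) Prod.swap Finset.univ).card : ℝ) := by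
          exact_mod_cast hcount
      _ ≤ ∑ σ ∈ Λ, Real.exp X := Finset.sum_le_sum fun σ hσ =>
          card_typedMatchings_halfEdgeType_le σ (by rw [Fintype.card_fin]) hM0 (hentropy σ hσ)
      _ = Λ.card * Real.exp X := by rw [Finset.sum_const, nsmul_eq_mul]
      _ ≤ _ := by gcongr
  have hnum : 0 < numPorted d n := Nat.mul_pos hpos (pow_pos (Nat.factorial_pos d) n)
  have hupper : Real.log (numPorted d n) ≤ Real.log 2 + (n * (H + 2 * δ) + X) := by
    rw [← Real.exp_add] at hcount'
    have h4 : (numPorted d n : ℝ) ≤ 2 * Real.exp (n * (H + 2 * δ) + X) := by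
      have h5 : numPorted d n ≤ 2 * (A.card * d.factorial ^ n) := by
        rw [← mul_assoc]
        exact Nat.mul_le_mul_right _ hcard
      have h6 : (numPorted d n : ℝ) ≤ 2 * (A.card * d.factorial ^ n) := by exact_mod_cast h5
      linarith
    have h7 := Real.log_le_log (by exact_mod_cast hnum) h4
    rwa [Real.log_mul (by norm_num) (Real.exp_pos _).ne', Real.log_exp] at h7
  have hlower := hlow n (by omega) hnum
  have herr := hN₂ n (by omega)
  rw [← hMn] at hlower
  rw [← hM] at herr
  -- The errors per vertex are `2 δ` from the star labels, `δ` from the lower bound on ported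
  -- graphs, `δ` from the constants and logarithms, and `(d / 2) δ` from the type entropy.
  have hfinal : (n : ℝ) * (d / 2 * h) ≤ n * (H + (4 + d / 2) * δ) := by
    have e1 : (M : ℝ) * (h - δ) = d * n * (h - δ) := by rw [hMn]
    rw [hX] at hupper
    rw [e1] at hupper
    nlinarith
  exact le_of_mul_le_mul_left hfinal hn0'

end EntropyInequality

end TypicalProcess

end

/-! ### Conclusion, with the degree-one case apart -/

theorem theorem4p3 {V S : Type*} [Fintype S] [MeasurableSpace S] [DiscreteMeasurableSpace S]
    (d : ℕ) (T : SimpleGraph V) [T.LocallyFinite] (hT : TypicalProcess.IsRegularTree d T) (o : V)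
    (ν : MeasureTheory.Measure (V → S)) (hν : TypicalProcess.IsTypical d T o ν)
    (z u w : V) (huw : T.Adj u w) :
    TypicalProcess.configEntropy ν (TypicalProcess.star T z) ≥
      (d : ℝ) / 2 * TypicalProcess.configEntropy ν (TypicalProcess.edge u w) := by
  classical
  have hd : 0 < d := by
    rw [← hT.regular u]
    exact (T.degree_pos_iff_exists_adj u).2 ⟨w, huw⟩
  have hinv := hν.1
  have := hinv.isProbabilityMeasure
  obtain ⟨ρ⟩ := hT.exists_equiv o
  rcases Nat.lt_or_ge 1 d with h2 | h1
  · let j : Fin d := ⟨0, hd⟩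
    rw [hinv.configEntropy_star hT ρ z, hinv.configEntropy_edge hT ρ j huw, ge_iff_le]
    refine le_of_forall_pos_le_add fun δ hδ => ?_
    have h := hν.entropy_le hT h2 ρ j (δ := δ / (4 + d / 2)) (by positivity)
    rwa [mul_div_cancel₀ _ (by positivity)] at h
  -- A `1`-regular graph has no cycles, so large girth does not make `n` large. Here the star is
  -- itself an edge, and the inequality reduces to nonnegativity of entropy.
  · obtain rfl : d = 1 := by omega
    have hnbr : T.neighborFinset u = {w} := by
      obtain ⟨x, hx⟩ := Finset.card_eq_one.1 (hT.regular u)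
      have hw : w ∈ T.neighborFinset u := (T.mem_neighborFinset u w).2 huw
      rw [hx, Finset.mem_singleton] at hw
      rw [hx, hw]
    have hstar : TypicalProcess.star T u = TypicalProcess.edge u w := by
      rw [TypicalProcess.star, hnbr, TypicalProcess.edge]
    have h0 : 0 ≤ TypicalProcess.configEntropy ν (TypicalProcess.star T z) := by
      rw [hinv.configEntropy_star hT ρ z]
      exact Finset.sum_nonneg fun c _ =>
        Real.negMulLog_nonneg (TypicalProcess.patternProb_nonneg _ _ _)
          MeasureTheory.measureReal_le_one
    have heq : TypicalProcess.configEntropy ν (TypicalProcess.edge u w) =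
        TypicalProcess.configEntropy ν (TypicalProcess.star T z) := by
      rw [← hstar, hinv.configEntropy_star hT ρ z, hinv.configEntropy_star hT ρ u]
    rw [heq]
    push_cast
    linarith
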